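/- For $R>0$ let $w_R(x)=\frac1{\pi R^2}\int_{B(0,R)}\log|x-y|\,\mathrm dy$, and let $w_0(x)=\log|x|$, for $x\in\mathbb R^2$. Write $\nabla^\perp=(-\partial_2,\partial_1)$, $\mathbf A^{R}[|u|^2]=\nabla^\perp w_R*|u|^2$ and $J[u]=\mathrm i(u\nabla\overline u-\overline u\nabla u)$. For $\beta\in\mathbb R$, $R\ge0$, $u_0\in H^2(\mathbb R^2;\mathbb C)$ and an interval $I\subseteq[0,\infty)$ containing $0$, a solution of $\mathrm{CSS}(R,u_0)$ on $I$ is a map $u\in C(I;H^2(\mathbb R^2))$, $t\mapsto u_t$, that is differentiable as a map from $I$ to $L^2(\mathbb R^2)$ (one-sidedly at endpoints of $I$) and satisfies $$\mathrm i\partial_t u=\big(-\mathrm i\nabla+\beta\mathbf A^{R}[|u|^2]\big)^2u-\beta\Big[\nabla^\perp w_R*\big(2\beta\mathbf A^{R}[|u|^2]\,|u|^2+J[u]\big)\Big]u\quad\text{in }L^2\text{ for all }t\in I,$$ with initial value $u_0$ at $t=0$; the convolution of two vector fields is taken with the scalar product of $\mathbb R^2$. The average-field energy is $$\mathcal E_R^{\mathrm{af}}[u]=\int_{\mathbb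 R^2}\big|(-\mathrm i\nabla+\beta\mathbf A^{R}[|u|^2])u\big|^2.$$ **Theorem.** There exist a constant $c>0$ and a function $C:\mathbb R\times\mathbb R\to\mathbb R$ such that for all $\beta\in\mathbb R$, all $0\le R\le c$, all $u_0\in H^2(\mathbb R^2)$, every interval $I\subseteq[0,\infty)$ containing $0$ and every solution $u$ of $\mathrm{CSS}(R,u_0)$ on $I$, one has for all $t\in I$ $$\mathcal E_R^{\mathrm{af}}[u_t]=\mathcal E_R^{\mathrm{af}}[u_0]\qquad\text{and}\qquad \|u_t\|_{H^1}\le C\big(\beta,\|u_0\|_{H^1}\big),$$ where $\|f\|_{H^1}^2=\|f\|_{L^2}^2+\|\nabla f\|_{L^2}^2$. In particular, the bound does not depend on $R$, on $t$ or on $I$; for $I=[0,\infty)$ both statements hold for all $t\ge0$. -/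

import Mathlib

open MeasureTheory Filter Topology
open scoped SchwartzMap LineDeriv

namespace CSS

/-- The plane `ℝ²` with its Euclidean norm and Lebesgue measure. -/
abbrev Plane : Type := EuclideanSpace ℝ (Fin 2)

/-- The complex Hilbert space `L²(ℝ²)`. -/
abbrev L2 : Type := Lp ℂ 2 (volume : Measure Plane)

/-- The standard unit vector in the `j`-th coordinate direction. -/
noncomputable def e (j : Fin 2) : Plane := EuclideanSpace.single j 1

/-! ### Sobolev spaces -/

/-- `g ∈ L²` is the weak (distributional) partial derivative `∂ⱼ f` of `f ∈ L²`. -/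
def HasWeakPartial (j : Fin 2) (f g : L2) : Prop :=
  ∂_{e j} (f : 𝓢'(Plane, ℂ)) = (g : 𝓢'(Plane, ℂ))

open Classical in
/-- The weak partial derivative `∂ⱼ f ∈ L²` of `f ∈ L²`; it is set to `0` when the distributional
derivative is not in `L²`, which never happens for `f ∈ H¹`. -/
noncomputable def weakPartial (j : Fin 2) (f : L2) : L2 :=
  if h : ∃ g : L2, HasWeakPartial j f g then h.choose else 0

/-- Membership of `f ∈ L²` in `H²(ℝ²)`. -/
def MemH2 (f : L2) : Prop :=
  TemperedDistribution.MemSobolev 2 2 (f : 𝓢'(Plane, ℂ))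

/-- The norm of `H¹(ℝ²)`: `‖f‖² = ‖f‖₂² + ‖∇f‖₂²`. -/
noncomputable def h1Norm (f : L2) : ℝ :=
  √(‖f‖ ^ 2 + ∑ j, ‖weakPartial j f‖ ^ 2)

/-- The norm of `H²(ℝ²)`: `‖f‖² = ‖f‖₂² + ‖∇f‖₂² + ‖∇²f‖₂²`. -/
noncomputable def h2Norm (f : L2) : ℝ :=
  √(‖f‖ ^ 2 + (∑ j, ‖weakPartial j f‖ ^ 2) + ∑ j, ∑ k, ‖weakPartial j (weakPartial k f)‖ ^ 2)

/-! ### The smeared Coulomb potential and the self-generated vector potential -/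

/-- The Coulomb potential of a unit charge smeared over the disc of radius `R`:
`w_R = log |·| ∗ 𝟙_{B(0,R)} / (π R²)` for `R > 0`, and `w₀ = log |·|`. -/
noncomputable def w (R : ℝ) (x : Plane) : ℝ :=
  if R = 0 then Real.log ‖x‖
  else ∫ y in Metric.ball (0 : Plane) R, Real.log ‖x - y‖ / (Real.pi * R ^ 2)

/-- The perpendicular gradient `∇^⊥ f = (-∂₂ f, ∂₁ f)` of a real function on the plane
(classical derivatives). -/
noncomputable def perpGrad (f : Plane → ℝ) (x : Plane) : Fin 2 → ℝ :=
  ![-(fderiv ℝ f x (e 1)), fderiv ℝ f x (e 0)]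

/-- The `j`-th component of `A^R[|u|²] = ∇^⊥ w_R ∗ |u|²`. -/
noncomputable def vecPot (R : ℝ) (u : L2) (j : Fin 2) (x : Plane) : ℝ :=
  ∫ y, perpGrad (w R) (x - y) j * ‖u y‖ ^ 2

/-- The `j`-th component of `J[u] = i (u ∇ū - ū ∇u)`. -/
noncomputable def current (u : L2) (j : Fin 2) (x : Plane) : ℂ :=
  Complex.I * (u x * (starRingEnd ℂ) (weakPartial j u x)
    - (starRingEnd ℂ) (u x) * weakPartial j u x)

/-- The scalar function `∇^⊥ w_R ∗ (2 β A^R[|u|²] |u|² + J[u])`; the convolution of the two vector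
fields is taken with the scalar product of `ℝ²`. -/
noncomputable def scalarConv (β R : ℝ) (u : L2) (x : Plane) : ℂ :=
  ∫ y, ∑ j, (perpGrad (w R) (x - y) j : ℂ) *
    (2 * (β : ℂ) * (vecPot R u j y : ℂ) * ((‖u y‖ ^ 2 : ℝ) : ℂ) + current u j y)

/-! ### The equation and the energy -/

open Classical in
/-- The product of a function `a` with `f ∈ L²`, as an element of `L²`; it is set to `0` when the
product is not square integrable. (For `u ∈ H²` the functions `vecPot R u j` and
`scalarConv β R u` are bounded, so this does not occur below.) -/
noncomputable def mulL2 (a : Plane → ℂ) (f : L2) : L2 :=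
  if h : MemLp (fun x => a x * f x) 2 (volume : Measure Plane) then h.toLp _ else 0

/-- The `j`-th component of the magnetic momentum `(-i ∇ + β A^R[|u|²]) f`. -/
noncomputable def magMomentum (β R : ℝ) (u : L2) (j : Fin 2) (f : L2) : L2 :=
  -(Complex.I • weakPartial j f) + (β : ℂ) • mulL2 (fun x => (vecPot R u j x : ℂ)) f

/-- The right-hand side of the Chern–Simons–Schrödinger equation,
`(-i ∇ + β A^R[|u|²])² u - β [∇^⊥ w_R ∗ (2 β A^R[|u|²] |u|² + J[u])] u`. -/
noncomputable def cssRHS (β R : ℝ) (u : L2) : L2 :=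
  (∑ j, magMomentum β R u j (magMomentum β R u j u)) - (β : ℂ) • mulL2 (scalarConv β R u) u

/-- The average-field energy (without external potential)
`E_R^af[u] = ∫ |(-i ∇ + β A^R[|u|²]) u|²`. -/
noncomputable def afEnergy (β R : ℝ) (u : L2) : ℝ :=
  ∑ j, ‖magMomentum β R u j u‖ ^ 2

/-- `u` is a solution of `CSS(R, u₀)` with coupling `β` on the time interval `T`: it is a continuous
curve in `H²`, differentiable in `L²`, with `u(0) = u₀` and `i ∂ₜ u = cssRHS β R u`. -/
structure IsSolution (β R : ℝ) (u₀ : L2) (T : Set ℝ) (u : ℝ → L2) : Prop where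
  memH2 : ∀ t ∈ T, MemH2 (u t)
  continuous_h2 : ∀ t ∈ T, Tendsto (fun s => h2Norm (u s - u t)) (𝓝[T] t) (𝓝 0)
  initial : u 0 = u₀
  equation : ∀ t ∈ T, ∃ du : L2, HasDerivWithinAt u du T t ∧ Complex.I • du = cssRHS β R (u t)

end CSS

namespace CSS

open Metric Set

/-! ### The smeared Coulomb kernel -/

/-! The flow is Hamiltonian: to first order the energy at `u` changes by `2 Re ⟪cssRHS β R u, ·⟫`,
so along `i ∂ₜu = cssRHS` its derivative is `2 Re ⟪i ∂ₜu, ∂ₜu⟫ = 0`. The nonlocal scalar term of the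
equation is what varying the vector potential contributes, once the odd kernel `∇^⊥ w_R` is moved
onto the current `2 Re (ū Pⱼu)`, where `Pⱼ = -i∂ⱼ + βAⱼ` (`currentDens_ae_eq`,
`sum_inner_conv_densIncrement`).

Solutions are differentiable only in `L²`, whereas the energy contains gradients. The expansion of
the energy is therefore exact (`afEnergy_sub_eq`), and its remainder is bounded by `‖v - u‖` times
the `H²` norm of `v - u` (`abs_afEnergy_sub_le`). Along a solution the first factor is `O(|s - t|)`
and the second is `o(1)`. Pairing `Pⱼ(Pⱼu)` with test functions requires a genuine weak derivative
of `Pⱼu`, supplied by `hasWeakPartial_mulL2_conv`. Mass is conserved because `⟪cssRHS β R u, u⟫` is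
real.

Uniformity in `R` rests on `|∇w_R(x)| ≤ 36/|x|` (`norm_fderiv_w_le`), which bounds `A` by `sup_x ∫
|u(y)|²/|x - y| dy`. The Hardy-type inequality `MemH1.hardy_le_of_re_eq` controls this supremum by
`‖u‖` and any fields `hⱼ` with `Re(ū hⱼ) = Re(ū ∂ⱼu)`. The choice `hⱼ = i Pⱼu` is a diamagnetic
bound of `A` by mass and energy alone, so `∂ⱼu`, which differs from `i Pⱼu` by `iβAⱼu`, is bounded
by conserved quantities. -/

lemma volume_real_ball_plane (x : Plane) {r : ℝ} (hr : 0 ≤ r) :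
    (volume : Measure Plane).real (ball x r) = Real.pi * r ^ 2 := by
  rw [measureReal_def, EuclideanSpace.volume_ball_fin_two, ENNReal.toReal_mul, ENNReal.toReal_pow,
    ENNReal.toReal_ofReal hr]
  simp [mul_comm, Real.pi_pos.le]

/-- In polar coordinates the planar Jacobian `t` cancels the singularity `t⁻¹`. -/
lemma integrableOn_inv_norm_ball (r : ℝ) :
    IntegrableOn (fun y : Plane => ‖y‖⁻¹) (ball 0 r) := by
  rw [integrableOn_fun_norm_addHaar volume (f := fun t : ℝ => t⁻¹)]
  have : IntegrableOn (fun _ : ℝ => (1 : ℝ)) (Ioo 0 r) := by simp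
  refine this.congr_fun (fun t ht => ?_) measurableSet_Ioo
  have : t ≠ 0 := ht.1.ne'
  simp [this]

lemma setIntegral_inv_norm_ball {r : ℝ} (hr : 0 ≤ r) :
    ∫ y in ball (0 : Plane) r, ‖y‖⁻¹ = 2 * Real.pi * r := by
  have h1 : ∫ y in ball (0 : Plane) r, ‖y‖⁻¹ =
      ∫ y : Plane, (Iio r).indicator (fun t : ℝ => t⁻¹) ‖y‖ := by
    rw [← integral_indicator measurableSet_ball]
    congr 1 with y
    simp [indicator]
  rw [h1, integral_fun_norm_addHaar volume]
  have h2 : ∫ y in Ioi (0 : ℝ), y ^ (Module.finrank ℝ Plane - 1) •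
      (Iio r).indicator (fun t : ℝ => t⁻¹) y = r := by
    have h3 : ∫ y in Ioi (0 : ℝ), (Ioo 0 r).indicator (fun _ => (1 : ℝ)) y = r := by
      rw [setIntegral_indicator measurableSet_Ioo, inter_eq_right.2 Ioo_subset_Ioi_self]
      simp [hr]
    refine Eq.trans ?_ h3
    refine setIntegral_congr_fun measurableSet_Ioi (fun y hy => ?_)
    have : y ≠ 0 := (mem_Ioi.1 hy).ne'
    by_cases h : y < r
    · simp [indicator, h, mem_Ioi.1 hy, this]
    · simp [indicator, h]
  rw [h2, volume_real_ball_plane 0 zero_le_one]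
  simp [mul_assoc]

lemma integrableOn_inv_norm_sub_ball (x z : Plane) (r : ℝ) :
    IntegrableOn (fun y : Plane => ‖x - y‖⁻¹) (ball z r) := by
  have h := integrableOn_inv_norm_ball (‖x - z‖ + r)
  rw [← integrable_indicator_iff measurableSet_ball] at h ⊢
  have h' := h.comp_sub_left x
  rw [integrable_indicator_iff measurableSet_ball]
  have h'' : IntegrableOn (fun y => (ball (0 : Plane) (‖x - z‖ + r)).indicator
    (fun y : Plane => ‖y‖⁻¹) (x - y)) (ball z r) := h'.integrableOn
  refine h''.congr_fun (fun y hy => ?_) measurableSet_ball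
  have : ‖x - y‖ < ‖x - z‖ + r := by
    have h1 : ‖x - y‖ ≤ ‖x - z‖ + ‖z - y‖ := norm_sub_le_norm_sub_add_norm_sub ..
    rw [mem_ball, dist_comm, dist_eq_norm] at hy
    linarith
  simp [indicator, this]

lemma setIntegral_inv_norm_sub_ball (x : Plane) {r : ℝ} (hr : 0 ≤ r) :
    ∫ y in ball x r, ‖x - y‖⁻¹ = 2 * Real.pi * r := by
  rw [← setIntegral_inv_norm_ball hr, ← integral_indicator measurableSet_ball,
    ← integral_indicator measurableSet_ball, ← integral_sub_left_eq_self _ volume x]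
  congr 1 with y
  simp [indicator, dist_eq_norm]

/-- Far from the disc, `|x - y| ≥ |x|/2` on it. Otherwise `|x| < 2R`, and the disc lies in `ball x
(3R)`, whose integral `6πR` gives `6/R < 12/|x|`; this case fixes the constant. -/
lemma average_inv_norm_sub_le {R : ℝ} (hR : 0 < R) {x : Plane} (hx : x ≠ 0) :
    (∫ y in ball (0 : Plane) R, ‖x - y‖⁻¹) / (Real.pi * R ^ 2) ≤ 12 / ‖x‖ := by
  have hx' : 0 < ‖x‖ := norm_pos_iff.2 hx
  have hp := Real.pi_pos
  rw [div_le_iff₀ (by positivity)]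
  rcases le_or_gt (2 * R) ‖x‖ with h | h
  · calc ∫ y in ball (0 : Plane) R, ‖x - y‖⁻¹
        ≤ ∫ y in ball (0 : Plane) R, 2 / ‖x‖ := by
          refine setIntegral_mono_on (integrableOn_inv_norm_sub_ball _ _ _)
            (integrableOn_const measure_ball_lt_top.ne)
            measurableSet_ball (fun y hy => ?_)
          rw [mem_ball_zero_iff] at hy
          have : ‖x‖ / 2 ≤ ‖x - y‖ := by linarith [norm_sub_norm_le x y]
          calc ‖x - y‖⁻¹ ≤ (‖x‖ / 2)⁻¹ := inv_anti₀ (by positivity) this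
            _ = 2 / ‖x‖ := by rw [inv_div]
      _ = 2 / ‖x‖ * (Real.pi * R ^ 2) := by
          rw [setIntegral_const, volume_real_ball_plane 0 hR.le, smul_eq_mul, mul_comm]
      _ ≤ 12 / ‖x‖ * (Real.pi * R ^ 2) := by gcongr; norm_num
  · calc ∫ y in ball (0 : Plane) R, ‖x - y‖⁻¹
        ≤ ∫ y in ball x (3 * R), ‖x - y‖⁻¹ := by
          refine setIntegral_mono_set (integrableOn_inv_norm_sub_ball _ _ _)
            (ae_of_all _ fun y => by positivity) (LE.le.eventuallyLE ?_)
          refine ball_subset_ball' ?_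
          rw [dist_zero_left]; linarith
      _ = 6 * Real.pi * R := by rw [setIntegral_inv_norm_sub_ball x (by positivity)]; ring
      _ ≤ 12 / ‖x‖ * (Real.pi * R ^ 2) := by
          rw [div_mul_eq_mul_div, le_div_iff₀ hx']
          have := mul_le_mul_of_nonneg_left h.le (by positivity : 0 ≤ 6 * Real.pi * R)
          nlinarith

lemma abs_log_sub_log_le {a b : ℝ} (ha : 0 < a) (hb : 0 < b) :
    |Real.log a - Real.log b| ≤ |a - b| * (a⁻¹ + b⁻¹) := by
  have key : ∀ {a b : ℝ}, 0 < a → 0 < b → Real.log a - Real.log b ≤ |a - b| * (a⁻¹ + b⁻¹) := by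
    intro a b ha hb
    rw [← Real.log_div ha.ne' hb.ne']
    calc Real.log (a / b) ≤ a / b - 1 := Real.log_le_sub_one_of_pos (by positivity)
      _ = (a - b) * b⁻¹ := by field_simp
      _ ≤ |a - b| * b⁻¹ := by gcongr; exact le_abs_self _
      _ ≤ |a - b| * (a⁻¹ + b⁻¹) := by gcongr; simp [ha.le]
  rw [abs_le']
  refine ⟨key ha hb, ?_⟩
  have := key hb ha
  rw [abs_sub_comm, add_comm] at this
  linarith

lemma integrableOn_log_norm_sub_ball (x z : Plane) (r : ℝ) :
    IntegrableOn (fun y : Plane => Real.log ‖x - y‖) (ball z r) := by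
  have h1 : IntegrableOn (fun y : Plane => ‖x - y‖ + ‖x - y‖⁻¹) (ball z r) := by
    refine IntegrableOn.add ?_ (integrableOn_inv_norm_sub_ball x z r)
    have : ContinuousOn (fun y : Plane => ‖x - y‖) (closedBall z r) := by fun_prop
    exact (this.integrableOn_compact (isCompact_closedBall z r)).mono_set ball_subset_closedBall
  refine Integrable.mono' h1 ?_ (ae_of_all _ fun y => ?_)
  · exact (Real.measurable_log.comp (by fun_prop)).aestronglyMeasurable
  · rcases (norm_nonneg (x - y)).eq_or_lt with h | h
    · simp [← h]
    · rw [Real.norm_eq_abs, abs_le']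
      have h2 := Real.log_le_sub_one_of_pos h
      have h3 := Real.log_le_sub_one_of_pos (inv_pos.2 h)
      rw [Real.log_inv] at h3
      have := inv_pos.2 h
      constructor <;> linarith

/-- The logarithmic difference is bounded inside the average, so only averages of `1/|x - y|`
appear. No differentiation under the integral, and no differentiability of `w R`, is needed. -/
lemma abs_w_sub_w_le {R : ℝ} (hR : 0 ≤ R) {x z : Plane} (hx : x ≠ 0) (hz : z ≠ 0) :
    |w R x - w R z| ≤ ‖x - z‖ * (12 / ‖x‖ + 12 / ‖z‖) := by
  have hx' : 0 < ‖x‖ := norm_pos_iff.2 hx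
  have hz' : 0 < ‖z‖ := norm_pos_iff.2 hz
  rcases hR.eq_or_lt with rfl | hR
  · simp only [w, if_true]
    refine (abs_log_sub_log_le hx' hz').trans ?_
    have h12 : ∀ a : ℝ, 0 ≤ a → a⁻¹ ≤ 12 / a := fun a ha => by
      rw [← one_div]; gcongr; norm_num
    gcongr
    · exact abs_norm_sub_norm_le x z
    · exact h12 _ hx'.le
    · exact h12 _ hz'.le
  · have hp := Real.pi_pos
    simp only [w, if_neg hR.ne']
    have hd : ∀ x : Plane, IntegrableOn (fun y : Plane => Real.log ‖x - y‖ / (Real.pi * R ^ 2))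
        (ball 0 R) := fun x => (integrableOn_log_norm_sub_ball x 0 R).div_const _
    have hi : ∀ x : Plane, IntegrableOn (fun y : Plane => ‖x - y‖⁻¹) (ball 0 R) :=
      fun x => integrableOn_inv_norm_sub_ball x 0 R
    rw [← integral_sub (hd x) (hd z)]
    have hne : ∀ x : Plane, ∀ᵐ y ∂(volume.restrict (ball (0 : Plane) R)), x - y ≠ 0 := by
      intro x
      have : ∀ᵐ y ∂(volume : Measure Plane), y ≠ x := by
        simp [ae_iff]
      filter_upwards [ae_restrict_of_ae this] with y hy
      exact sub_ne_zero.2 hy.symm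
    calc |∫ y in ball (0 : Plane) R, (Real.log ‖x - y‖ / (Real.pi * R ^ 2) -
            Real.log ‖z - y‖ / (Real.pi * R ^ 2))|
        ≤ ∫ y in ball (0 : Plane) R,
            ‖x - z‖ * (‖x - y‖⁻¹ + ‖z - y‖⁻¹) / (Real.pi * R ^ 2) := by
          rw [← Real.norm_eq_abs]
          refine norm_integral_le_of_norm_le ((((hi x).add (hi z)).const_mul _).div_const _) ?_
          filter_upwards [hne x, hne z] with y hxy hzy
          rw [← sub_div, norm_div, Real.norm_eq_abs, Real.norm_of_nonneg (by positivity)]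
          gcongr
          refine (abs_log_sub_log_le (norm_pos_iff.2 hxy) (norm_pos_iff.2 hzy)).trans ?_
          gcongr
          simpa using abs_norm_sub_norm_le (x - y) (z - y)
      _ = ‖x - z‖ * ((∫ y in ball (0 : Plane) R, ‖x - y‖⁻¹) / (Real.pi * R ^ 2) +
            (∫ y in ball (0 : Plane) R, ‖z - y‖⁻¹) / (Real.pi * R ^ 2)) := by
          rw [integral_div, integral_const_mul, integral_add (hi x) (hi z)]
          ring
      _ ≤ ‖x - z‖ * (12 / ‖x‖ + 12 / ‖z‖) := by
          exact mul_le_mul_of_nonneg_left (add_le_add (average_inv_norm_sub_le hR hx)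
            (average_inv_norm_sub_le hR hz)) (norm_nonneg _)

lemma w_neg (R : ℝ) (x : Plane) : w R (-x) = w R x := by
  unfold w
  split_ifs
  · simp
  · rw [← integral_indicator measurableSet_ball, ← integral_indicator measurableSet_ball,
      ← integral_neg_eq_self]
    congr 1 with y
    have : ‖-x + y‖ = ‖x - y‖ := by rw [← norm_neg]; congr 1; abel
    simp [indicator, this]

lemma fderiv_w_neg (R : ℝ) (x : Plane) : fderiv ℝ (w R) (-x) = -fderiv ℝ (w R) x := by
  have h := (ContinuousLinearEquiv.neg ℝ (M := Plane)).comp_right_fderiv (f := w R) (x := x)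
  rw [show w R ∘ ContinuousLinearEquiv.neg ℝ (M := Plane) = w R from funext (w_neg R)] at h
  rw [h]
  ext v
  simp

/-- A local Lipschitz constant dominates `fderiv` whether or not the derivative exists. Near `x` one
has `|z| ≥ |x|/2`, hence `36 = 24 + 12`. -/
lemma norm_fderiv_w_le {R : ℝ} (hR : 0 ≤ R) (x : Plane) :
    ‖fderiv ℝ (w R) x‖ ≤ 36 * ‖x‖⁻¹ := by
  rcases eq_or_ne x 0 with rfl | hx
  -- Since `‖0‖⁻¹ = 0` here, the derivative at the origin must vanish; it does because it is odd.
  · have := fderiv_w_neg R 0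
    rw [neg_zero, eq_neg_iff_add_eq_zero, ← two_smul ℝ, smul_eq_zero] at this
    simp [this.resolve_left two_ne_zero]
  · have hx' : 0 < ‖x‖ := norm_pos_iff.2 hx
    refine norm_fderiv_le_of_lip' ℝ (by positivity) ?_
    filter_upwards [ball_mem_nhds x (half_pos hx')] with z hz
    rw [mem_ball, dist_eq_norm] at hz
    have h1 : ‖x‖ / 2 ≤ ‖z‖ := by
      have := norm_sub_norm_le x z
      rw [norm_sub_rev] at this
      linarith
    have hz' : 0 < ‖z‖ := by linarith
    rw [Real.norm_eq_abs]
    refine (abs_w_sub_w_le hR (norm_pos_iff.1 hz') hx).trans ?_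
    rw [mul_comm]
    gcongr
    have : 12 / ‖z‖ ≤ 24 * ‖x‖⁻¹ := by
      calc 12 / ‖z‖ ≤ 12 / (‖x‖ / 2) := by gcongr
        _ = 24 * ‖x‖⁻¹ := by field_simp; norm_num
    rw [div_eq_mul_inv 12 ‖x‖]
    linarith

lemma measurable_perpGrad_w (R : ℝ) (j : Fin 2) : Measurable fun x => perpGrad (w R) x j := by
  fin_cases j
  · exact (measurable_fderiv_apply_const ℝ (w R) (e 1)).neg
  · exact measurable_fderiv_apply_const ℝ (w R) (e 0)

lemma perpGrad_w_neg (R : ℝ) (j : Fin 2) (x : Plane) :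
    perpGrad (w R) (-x) j = -perpGrad (w R) x j := by
  fin_cases j <;> simp [perpGrad, fderiv_w_neg]

lemma norm_e (j : Fin 2) : ‖e j‖ = 1 := by simp [e]

lemma abs_perpGrad_w_le {R : ℝ} (hR : 0 ≤ R) (j : Fin 2) (x : Plane) :
    |perpGrad (w R) x j| ≤ 36 * ‖x‖⁻¹ := by
  have h : ∀ i, |fderiv ℝ (w R) x (e i)| ≤ 36 * ‖x‖⁻¹ := fun i => by
    have := (fderiv ℝ (w R) x).le_opNorm (e i)
    rw [norm_e, mul_one] at this
    exact this.trans (norm_fderiv_w_le hR x)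
  fin_cases j
  · simpa [perpGrad] using h 1
  · simpa [perpGrad] using h 0

end CSS

namespace CSS

open scoped ENNReal

/-! ### Riesz potentials and convolution with the kernel -/

/-- The supremum of the Riesz potential `∫ |σ(y)| / |x - y| dy` of a density `σ`. -/
noncomputable def riesz (σ : Plane → ℂ) : ℝ≥0∞ := ⨆ x, ∫⁻ y, ‖σ y‖ₑ * ‖x - y‖ₑ⁻¹

/-- The supremum of the Riesz potential of `|f|²`. -/
noncomputable def hardy (f : Plane → ℂ) : ℝ≥0∞ := ⨆ x, ∫⁻ y, ‖f y‖ₑ ^ 2 * ‖x - y‖ₑ⁻¹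

/-- The convolution of the `j`-th component of `∇^⊥ w_R` with a complex density. -/
noncomputable def conv (R : ℝ) (j : Fin 2) (σ : Plane → ℂ) (x : Plane) : ℂ :=
  ∫ y, (perpGrad (w R) (x - y) j : ℂ) * σ y

lemma measurable_enorm_sub_inv (x : Plane) : Measurable fun y : Plane => ‖x - y‖ₑ⁻¹ := by
  fun_prop

lemma le_riesz (σ : Plane → ℂ) (x : Plane) : ∫⁻ y, ‖σ y‖ₑ * ‖x - y‖ₑ⁻¹ ≤ riesz σ :=
  le_iSup (fun x => ∫⁻ y, ‖σ y‖ₑ * ‖x - y‖ₑ⁻¹) x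

lemma le_hardy (f : Plane → ℂ) (x : Plane) : ∫⁻ y, ‖f y‖ₑ ^ 2 * ‖x - y‖ₑ⁻¹ ≤ hardy f :=
  le_iSup (fun x => ∫⁻ y, ‖f y‖ₑ ^ 2 * ‖x - y‖ₑ⁻¹) x

lemma hardy_congr {f g : Plane → ℂ} (h : f =ᵐ[volume] g) : hardy f = hardy g := by
  unfold hardy
  congr 1 with x
  refine lintegral_congr_ae ?_
  filter_upwards [h] with y hy
  rw [hy]

lemma riesz_add_le {σ τ : Plane → ℂ} (hσ : AEStronglyMeasurable σ volume) :
    riesz (fun y => σ y + τ y) ≤ riesz σ + riesz τ := by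
  refine iSup_le fun x => ?_
  calc ∫⁻ y, ‖σ y + τ y‖ₑ * ‖x - y‖ₑ⁻¹
      ≤ ∫⁻ y, (‖σ y‖ₑ * ‖x - y‖ₑ⁻¹ + ‖τ y‖ₑ * ‖x - y‖ₑ⁻¹) := by
        refine lintegral_mono fun y => ?_
        rw [← add_mul]
        gcongr
        exact enorm_add_le _ _
    _ = (∫⁻ y, ‖σ y‖ₑ * ‖x - y‖ₑ⁻¹) + ∫⁻ y, ‖τ y‖ₑ * ‖x - y‖ₑ⁻¹ :=
        lintegral_add_left' (hσ.enorm.mul (measurable_enorm_sub_inv x).aemeasurable) _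
    _ ≤ riesz σ + riesz τ := add_le_add (le_riesz σ x) (le_riesz τ x)

lemma hardy_add_le {f g : Plane → ℂ} (hf : AEStronglyMeasurable f volume) :
    hardy (fun y => f y + g y) ≤ 2 * hardy f + 2 * hardy g := by
  refine iSup_le fun x => ?_
  have h2 : ∀ a b : ℝ≥0∞, (a + b) ^ 2 ≤ 2 * a ^ 2 + 2 * b ^ 2 := fun a b => by
    have := ENNReal.rpow_add_le_mul_rpow_add_rpow a b (p := 2) one_le_two
    norm_num at this
    rw [← mul_add]
    exact_mod_cast this
  calc ∫⁻ y, ‖f y + g y‖ₑ ^ 2 * ‖x - y‖ₑ⁻¹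
      ≤ ∫⁻ y, (2 * (‖f y‖ₑ ^ 2 * ‖x - y‖ₑ⁻¹) + 2 * (‖g y‖ₑ ^ 2 * ‖x - y‖ₑ⁻¹)) := by
        refine lintegral_mono fun y => ?_
        rw [← mul_assoc, ← mul_assoc, ← add_mul]
        gcongr
        exact (pow_le_pow_left' (enorm_add_le _ _) 2).trans (h2 _ _)
    _ = 2 * (∫⁻ y, ‖f y‖ₑ ^ 2 * ‖x - y‖ₑ⁻¹) + 2 * ∫⁻ y, ‖g y‖ₑ ^ 2 * ‖x - y‖ₑ⁻¹ := by
        have hm : AEMeasurable (fun y => 2 * (‖f y‖ₑ ^ 2 * ‖x - y‖ₑ⁻¹)) volume :=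
          ((hf.enorm.pow_const 2).mul (measurable_enorm_sub_inv x).aemeasurable).const_mul _
        rw [lintegral_add_left' hm, lintegral_const_mul' _ _ (by simp),
          lintegral_const_mul' _ _ (by simp)]
    _ ≤ 2 * hardy f + 2 * hardy g := by
        gcongr
        · exact le_hardy f x
        · exact le_hardy g x

lemma hardy_mul_ne_top {a f : Plane → ℂ} {C : ℝ} (ha : ∀ x, ‖a x‖ ≤ C) (hf : hardy f ≠ ∞) :
    hardy (fun y => a y * f y) ≠ ∞ := by
  have h : hardy (fun y => a y * f y) ≤ ENNReal.ofReal C ^ 2 * hardy f := by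
    refine iSup_le fun x => ?_
    calc ∫⁻ y, ‖a y * f y‖ₑ ^ 2 * ‖x - y‖ₑ⁻¹
        ≤ ∫⁻ y, ENNReal.ofReal C ^ 2 * (‖f y‖ₑ ^ 2 * ‖x - y‖ₑ⁻¹) := by
          refine lintegral_mono fun y => ?_
          rw [enorm_mul, mul_pow, mul_assoc]
          gcongr
          rw [← ofReal_norm]
          exact ENNReal.ofReal_le_ofReal (ha y)
      _ = ENNReal.ofReal C ^ 2 * ∫⁻ y, (‖f y‖ₑ ^ 2 * ‖x - y‖ₑ⁻¹) :=
          lintegral_const_mul' _ _ (by simp)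
      _ ≤ ENNReal.ofReal C ^ 2 * hardy f := by gcongr; exact le_hardy f x
  exact (h.trans_lt (ENNReal.mul_lt_top (by simp) hf.lt_top)).ne

/-- Cauchy–Schwarz, with the weight `1/|x - y|` split into two square roots. -/
lemma riesz_le_hardy_mul_hardy {σ f g : Plane → ℂ} (hf : AEStronglyMeasurable f volume)
    (hg : AEStronglyMeasurable g volume) (h : ∀ᵐ y ∂volume, ‖σ y‖ ≤ ‖f y‖ * ‖g y‖) :
    riesz σ ≤ hardy f ^ (1 / 2 : ℝ) * hardy g ^ (1 / 2 : ℝ) := by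
  refine iSup_le fun x => ?_
  have hk := (measurable_enorm_sub_inv x).pow_const (1 / 2 : ℝ)
  have hsq : ∀ a b : ℝ≥0∞, (a * b ^ (1 / 2 : ℝ)) ^ (2 : ℝ) = a ^ 2 * b := fun a b => by
    rw [ENNReal.mul_rpow_of_nonneg _ _ zero_le_two, ← ENNReal.rpow_mul]
    norm_num
  calc ∫⁻ y, ‖σ y‖ₑ * ‖x - y‖ₑ⁻¹
      ≤ ∫⁻ y, (‖f y‖ₑ * ‖x - y‖ₑ⁻¹ ^ (1 / 2 : ℝ)) * (‖g y‖ₑ * ‖x - y‖ₑ⁻¹ ^ (1 / 2 : ℝ)) := by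
        refine lintegral_mono_ae ?_
        filter_upwards [h] with y hy
        have hσ : ‖σ y‖ₑ ≤ ‖f y‖ₑ * ‖g y‖ₑ := by
          rw [← ofReal_norm, ← ofReal_norm, ← ofReal_norm, ← ENNReal.ofReal_mul (norm_nonneg _)]
          exact ENNReal.ofReal_le_ofReal hy
        have hs : ‖x - y‖ₑ⁻¹ = ‖x - y‖ₑ⁻¹ ^ (1 / 2 : ℝ) * ‖x - y‖ₑ⁻¹ ^ (1 / 2 : ℝ) := by
          rw [← ENNReal.rpow_add_of_nonneg _ _ (by norm_num) (by norm_num)]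
          norm_num
        rw [mul_mul_mul_comm, ← hs]
        gcongr
    _ ≤ (∫⁻ y, (‖f y‖ₑ * ‖x - y‖ₑ⁻¹ ^ (1 / 2 : ℝ)) ^ (2 : ℝ)) ^ (1 / 2 : ℝ) *
        (∫⁻ y, (‖g y‖ₑ * ‖x - y‖ₑ⁻¹ ^ (1 / 2 : ℝ)) ^ (2 : ℝ)) ^ (1 / 2 : ℝ) :=
        ENNReal.lintegral_mul_le_Lp_mul_Lq _ Real.HolderConjugate.two_two
          (hf.enorm.mul hk.aemeasurable) (hg.enorm.mul hk.aemeasurable)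
    _ ≤ hardy f ^ (1 / 2 : ℝ) * hardy g ^ (1 / 2 : ℝ) := by
        simp_rw [hsq]
        gcongr
        · exact le_hardy f x
        · exact le_hardy g x

lemma riesz_ne_top {σ f g : Plane → ℂ} (hf : AEStronglyMeasurable f volume)
    (hg : AEStronglyMeasurable g volume) (h : ∀ᵐ y ∂volume, ‖σ y‖ ≤ ‖f y‖ * ‖g y‖)
    (hf' : hardy f ≠ ∞) (hg' : hardy g ≠ ∞) : riesz σ ≠ ∞ := by
  refine ((riesz_le_hardy_mul_hardy hf hg h).trans_lt (ENNReal.mul_lt_top ?_ ?_)).ne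
  · exact ENNReal.rpow_lt_top_of_nonneg (by norm_num) hf'
  · exact ENNReal.rpow_lt_top_of_nonneg (by norm_num) hg'

section

variable {R : ℝ} {j : Fin 2} {σ τ : Plane → ℂ}

lemma enorm_perpGrad_w_le (hR : 0 ≤ R) (j : Fin 2) (x : Plane) :
    ‖(perpGrad (w R) x j : ℂ)‖ₑ ≤ 36 * ‖x‖ₑ⁻¹ := by
  rcases eq_or_ne x 0 with rfl | hx
  · simp
  · rw [← ofReal_norm, ← ofReal_norm, ← ENNReal.ofReal_inv_of_pos (norm_pos_iff.2 hx),
      show (36 : ℝ≥0∞) = ENNReal.ofReal 36 by simp, ← ENNReal.ofReal_mul (by norm_num)]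
    refine ENNReal.ofReal_le_ofReal ?_
    simpa using abs_perpGrad_w_le hR j x

lemma lintegral_conv_le (hR : 0 ≤ R) (j : Fin 2) (σ : Plane → ℂ) (x : Plane) :
    ∫⁻ y, ‖(perpGrad (w R) (x - y) j : ℂ) * σ y‖ₑ ≤ 36 * riesz σ := by
  calc ∫⁻ y, ‖(perpGrad (w R) (x - y) j : ℂ) * σ y‖ₑ
      ≤ ∫⁻ y, 36 * (‖σ y‖ₑ * ‖x - y‖ₑ⁻¹) := by
        refine lintegral_mono fun y => ?_
        rw [enorm_mul, mul_comm ‖σ y‖ₑ, ← mul_assoc]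
        gcongr
        exact enorm_perpGrad_w_le hR j _
    _ = 36 * ∫⁻ y, ‖σ y‖ₑ * ‖x - y‖ₑ⁻¹ := lintegral_const_mul' _ _ (by simp)
    _ ≤ 36 * riesz σ := by gcongr; exact le_riesz σ x

lemma measurable_perpGrad_w_ofReal (R : ℝ) (j : Fin 2) :
    Measurable fun x => (perpGrad (w R) x j : ℂ) :=
  Complex.measurable_ofReal.comp (measurable_perpGrad_w R j)

lemma integrable_conv (hR : 0 ≤ R) (j : Fin 2) (hσ : AEStronglyMeasurable σ volume)
    (h : riesz σ ≠ ∞) (x : Plane) :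
    Integrable fun y => (perpGrad (w R) (x - y) j : ℂ) * σ y := by
  refine ⟨AEStronglyMeasurable.mul ?_ hσ, ?_⟩
  · exact ((measurable_perpGrad_w_ofReal R j).comp (by fun_prop)).aestronglyMeasurable
  · exact (lintegral_conv_le hR j σ x).trans_lt (ENNReal.mul_lt_top (by simp) h.lt_top)

lemma norm_conv_le (hR : 0 ≤ R) (j : Fin 2) (h : riesz σ ≠ ∞) (x : Plane) :
    ‖conv R j σ x‖ ≤ 36 * (riesz σ).toReal := by
  have h1 : ‖conv R j σ x‖ₑ ≤ 36 * riesz σ :=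
    (enorm_integral_le_lintegral_enorm _).trans (lintegral_conv_le hR j σ x)
  have h2 := ENNReal.toReal_mono (ENNReal.mul_lt_top (by simp) h.lt_top).ne h1
  simpa using h2

lemma norm_conv_le_sqrt (hR : 0 ≤ R) (j : Fin 2) {f g : Plane → ℂ}
    (hf : AEStronglyMeasurable f volume) (hg : AEStronglyMeasurable g volume)
    (h : ∀ᵐ y ∂volume, ‖σ y‖ ≤ ‖f y‖ * ‖g y‖) (hf' : hardy f ≠ ∞) (hg' : hardy g ≠ ∞)
    (x : Plane) :
    ‖conv R j σ x‖ ≤ 36 * (√(hardy f).toReal * √(hardy g).toReal) := by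
  refine (norm_conv_le hR j (riesz_ne_top hf hg h hf' hg') x).trans ?_
  have h2 := ENNReal.toReal_mono ?_ (riesz_le_hardy_mul_hardy hf hg h)
  · rw [ENNReal.toReal_mul, ← ENNReal.toReal_rpow, ← ENNReal.toReal_rpow, ← Real.sqrt_eq_rpow,
      ← Real.sqrt_eq_rpow] at h2
    gcongr
  · exact (ENNReal.mul_lt_top (ENNReal.rpow_lt_top_of_nonneg (by norm_num) hf')
      (ENNReal.rpow_lt_top_of_nonneg (by norm_num) hg')).ne

lemma aestronglyMeasurable_conv (R : ℝ) (j : Fin 2) (hσ : AEStronglyMeasurable σ volume) :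
    AEStronglyMeasurable (conv R j σ) volume := by
  have : AEStronglyMeasurable
      (fun p : Plane × Plane => (perpGrad (w R) (p.1 - p.2) j : ℂ) * σ p.2)
      ((volume : Measure Plane).prod volume) := by
    refine AEStronglyMeasurable.mul ?_ hσ.comp_snd
    exact ((measurable_perpGrad_w_ofReal R j).comp
      (measurable_fst.sub measurable_snd)).aestronglyMeasurable
  exact this.integral_prod_right'

lemma conv_congr (h : σ =ᵐ[volume] τ) (R : ℝ) (j : Fin 2) : conv R j σ = conv R j τ := by
  funext x
  refine integral_congr_ae ?_
  filter_upwards [h] with y hy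
  rw [hy]

lemma conv_add (hR : 0 ≤ R) (j : Fin 2) (hσ : AEStronglyMeasurable σ volume) (h : riesz σ ≠ ∞)
    (hτ : AEStronglyMeasurable τ volume) (h' : riesz τ ≠ ∞) (x : Plane) :
    conv R j (fun y => σ y + τ y) x = conv R j σ x + conv R j τ x := by
  unfold conv
  rw [← integral_add (integrable_conv hR j hσ h x) (integrable_conv hR j hτ h' x)]
  simp only [mul_add]

lemma conv_ofReal (R : ℝ) (j : Fin 2) (ρ : Plane → ℝ) (x : Plane) :
    conv R j (fun y => (ρ y : ℂ)) x = ((∫ y, perpGrad (w R) (x - y) j * ρ y : ℝ) : ℂ) := by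
  unfold conv
  rw [← integral_complex_ofReal]
  simp

lemma conv_conj (R : ℝ) (j : Fin 2) (σ : Plane → ℂ) (x : Plane) :
    conv R j (fun y => (starRingEnd ℂ) (σ y)) x = (starRingEnd ℂ) (conv R j σ x) := by
  unfold conv
  rw [← integral_conj]
  simp

/-- Fubini and the oddness of the kernel make the convolution antisymmetric. A finite Riesz supremum
for `σ` and integrability of `τ` give absolute convergence of the double integral. -/
lemma integral_conv_mul (hR : 0 ≤ R) (j : Fin 2) (hσ : AEStronglyMeasurable σ volume)
    (h : riesz σ ≠ ∞) (hτ : Integrable τ) :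
    ∫ x, conv R j σ x * τ x = -∫ x, σ x * conv R j τ x := by
  have hint : Integrable (fun p : Plane × Plane =>
      (perpGrad (w R) (p.1 - p.2) j : ℂ) * σ p.2 * τ p.1)
      ((volume : Measure Plane).prod volume) := by
    have hm : AEStronglyMeasurable (fun p : Plane × Plane =>
        (perpGrad (w R) (p.1 - p.2) j : ℂ) * σ p.2 * τ p.1)
        ((volume : Measure Plane).prod volume) := by
      refine (AEStronglyMeasurable.mul ?_ hσ.comp_snd).mul hτ.1.comp_fst
      exact ((measurable_perpGrad_w_ofReal R j).comp
        (measurable_fst.sub measurable_snd)).aestronglyMeasurable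
    refine ⟨hm, ?_⟩
    rw [hasFiniteIntegral_iff_enorm, lintegral_prod _ hm.enorm]
    calc ∫⁻ x, ∫⁻ y, ‖(perpGrad (w R) (x - y) j : ℂ) * σ y * τ x‖ₑ
        ≤ ∫⁻ x, 36 * riesz σ * ‖τ x‖ₑ := by
          refine lintegral_mono fun x => ?_
          simp only [enorm_mul _ (τ x)]
          rw [lintegral_mul_const' _ _ (by simp)]
          gcongr
          exact lintegral_conv_le hR j σ x
      _ = 36 * riesz σ * ∫⁻ x, ‖τ x‖ₑ :=
          lintegral_const_mul' _ _ (ENNReal.mul_lt_top (by simp) h.lt_top).ne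
      _ < ∞ := ENNReal.mul_lt_top (ENNReal.mul_lt_top (by simp) h.lt_top) hτ.2
  calc ∫ x, conv R j σ x * τ x
      = ∫ x, ∫ y, (perpGrad (w R) (x - y) j : ℂ) * σ y * τ x := by
        simp only [conv, integral_mul_const]
    _ = ∫ y, ∫ x, (perpGrad (w R) (x - y) j : ℂ) * σ y * τ x := integral_integral_swap hint
    _ = -∫ x, σ x * conv R j τ x := by
        rw [← integral_neg]
        congr 1 with y
        rw [conv, ← integral_const_mul, ← integral_neg]
        congr 1 with x
        rw [← neg_sub, perpGrad_w_neg]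
        push_cast
        ring

end

end CSS

namespace CSS

open TemperedDistribution
open scoped FourierTransform InnerProductSpace

/-! ### Weak derivatives -/

lemma toTemperedDistribution_injective {f g : L2}
    (h : (f : 𝓢'(Plane, ℂ)) = (g : 𝓢'(Plane, ℂ))) : f = g := by
  have hk := Lp.ker_toTemperedDistributionCLM_eq_bot (F := ℂ) (μ := (volume : Measure Plane))
    (p := 2)
  exact (LinearMap.ker_eq_bot.1 hk) h

lemma toTemperedDistribution_add (f g : L2) :
    ((f + g : L2) : 𝓢'(Plane, ℂ)) = (f : 𝓢'(Plane, ℂ)) + (g : 𝓢'(Plane, ℂ)) :=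
  (Lp.toTemperedDistributionCLM ℂ volume 2).map_add f g

lemma toTemperedDistribution_sub (f g : L2) :
    ((f - g : L2) : 𝓢'(Plane, ℂ)) = (f : 𝓢'(Plane, ℂ)) - (g : 𝓢'(Plane, ℂ)) :=
  (Lp.toTemperedDistributionCLM ℂ volume 2).map_sub f g

lemma toTemperedDistribution_smul (c : ℂ) (f : L2) :
    ((c • f : L2) : 𝓢'(Plane, ℂ)) = c • (f : 𝓢'(Plane, ℂ)) :=
  (Lp.toTemperedDistributionCLM ℂ volume 2).map_smul c f

lemma hasWeakPartial_iff {j : Fin 2} {f g : L2} :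
    HasWeakPartial j f g ↔
      ∀ φ : 𝓢(Plane, ℂ), ∫ x, φ x * g x = -∫ x, (∂_{e j} φ) x * f x := by
  unfold HasWeakPartial
  constructor
  · intro h φ
    have := DFunLike.congr_fun h φ
    rw [lineDerivOp_apply_apply, Lp.toTemperedDistribution_apply,
      Lp.toTemperedDistribution_apply] at this
    simp only [smul_eq_mul] at this
    rw [← this, ← integral_neg]
    congr 1 with x
    simp
  · intro h
    ext φ
    rw [lineDerivOp_apply_apply, Lp.toTemperedDistribution_apply,
      Lp.toTemperedDistribution_apply]
    simp only [smul_eq_mul]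
    rw [h φ, ← integral_neg]
    congr 1 with x
    simp

lemma HasWeakPartial.unique {j : Fin 2} {f g g' : L2} (h : HasWeakPartial j f g)
    (h' : HasWeakPartial j f g') : g = g' :=
  toTemperedDistribution_injective (h.symm.trans h')

lemma HasWeakPartial.weakPartial_eq {j : Fin 2} {f g : L2} (h : HasWeakPartial j f g) :
    weakPartial j f = g := by
  have hex : ∃ g : L2, HasWeakPartial j f g := ⟨g, h⟩
  rw [weakPartial, dif_pos hex]
  exact hex.choose_spec.unique h

lemma HasWeakPartial.add {j : Fin 2} {f f' g g' : L2} (h : HasWeakPartial j f g)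
    (h' : HasWeakPartial j f' g') : HasWeakPartial j (f + f') (g + g') := by
  unfold HasWeakPartial at *
  rw [toTemperedDistribution_add, toTemperedDistribution_add, LineDeriv.lineDerivOp_add, h, h']

lemma HasWeakPartial.smul {j : Fin 2} {f g : L2} (c : ℂ) (h : HasWeakPartial j f g) :
    HasWeakPartial j (c • f) (c • g) := by
  unfold HasWeakPartial at *
  rw [toTemperedDistribution_smul, toTemperedDistribution_smul, LineDeriv.lineDerivOp_smul, h]

/-- Membership of `f ∈ L²` in `H¹(ℝ²)`. -/
def MemH1 (f : L2) : Prop :=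
  TemperedDistribution.MemSobolev 1 2 (f : 𝓢'(Plane, ℂ))

lemma MemH2.memH1 {f : L2} (h : MemH2 f) : MemH1 f :=
  MemSobolev.mono (by norm_num) h

lemma MemH1.sub {f g : L2} (hf : MemH1 f) (hg : MemH1 g) : MemH1 (f - g) := by
  unfold MemH1
  rw [toTemperedDistribution_sub]
  exact MemSobolev.sub hf hg

lemma MemH2.sub {f g : L2} (hf : MemH2 f) (hg : MemH2 g) : MemH2 (f - g) := by
  unfold MemH2
  rw [toTemperedDistribution_sub]
  exact MemSobolev.sub hf hg

lemma MemH1.hasWeakPartial {f : L2} (h : MemH1 f) (j : Fin 2) :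
    HasWeakPartial j f (weakPartial j f) := by
  have h1 := MemSobolev.lineDerivOp (m := e j) h
  rw [sub_self, memSobolev_zero_iff] at h1
  have hex : ∃ g : L2, HasWeakPartial j f g := h1
  rw [weakPartial, dif_pos hex]
  exact hex.choose_spec

lemma MemH2.memH1_weakPartial {f : L2} (h : MemH2 f) (j : Fin 2) : MemH1 (weakPartial j f) := by
  have h1 := MemSobolev.lineDerivOp (m := e j) h
  have h2 : HasWeakPartial j f (weakPartial j f) := h.memH1.hasWeakPartial j
  unfold HasWeakPartial at h2
  rw [h2] at h1
  rw [show (2 : ℝ) - 1 = 1 by norm_num] at h1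
  exact h1

lemma weakPartial_sub {f g : L2} (hf : MemH1 f) (hg : MemH1 g) (j : Fin 2) :
    weakPartial j (f - g) = weakPartial j f - weakPartial j g := by
  have := (hf.hasWeakPartial j).add ((hg.hasWeakPartial j).smul (-1))
  simp only [neg_smul, one_smul, ← sub_eq_add_neg] at this
  exact this.weakPartial_eq

/-- A Schwartz function as an element of `L²`. -/
noncomputable abbrev toL2 (φ : 𝓢(Plane, ℂ)) : L2 := φ.toLp 2

lemma memH2_toLp (φ : 𝓢(Plane, ℂ)) : MemH2 (toL2 φ) := by
  unfold MemH2
  rw [Lp.toTemperedDistribution_toLp_eq]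
  exact φ.memSobolev

lemma hasWeakPartial_toLp (φ : 𝓢(Plane, ℂ)) (j : Fin 2) :
    HasWeakPartial j (toL2 φ) (toL2 (∂_{e j} φ)) := by
  unfold HasWeakPartial
  rw [Lp.toTemperedDistribution_toLp_eq, Lp.toTemperedDistribution_toLp_eq]
  exact lineDerivOp_toTemperedDistributionCLM_eq φ (e j)

/-! ### Density of Schwartz functions in `H¹` -/

/-- By Plancherel, the multiplier acts on the Fourier side as multiplication by a bounded function.
-/
lemma norm_le_of_fourierMultiplierCLM_eq {m : Plane → ℂ} (hm : m.HasTemperateGrowth) {C : ℝ}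
    (hC : ∀ x, ‖m x‖ ≤ C) {f g : L2}
    (h : fourierMultiplierCLM ℂ m (f : 𝓢'(Plane, ℂ)) = (g : 𝓢'(Plane, ℂ))) :
    ‖g‖ ≤ C * ‖f‖ := by
  have hC0 : 0 ≤ C := (norm_nonneg _).trans (hC 0)
  have hmt : MemLp m ⊤ (volume : Measure Plane) :=
    memLp_top_of_bound hm.1.continuous.aestronglyMeasurable C (ae_of_all _ hC)
  have hg : 𝓕 g = (hmt.toLp m • 𝓕 f : L2) := by
    apply toTemperedDistribution_injective
    rw [Lp.toTemperedDistribution_smul_eq hm hmt, ← Lp.fourier_toTemperedDistribution_eq,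
      ← Lp.fourier_toTemperedDistribution_eq, ← h, fourierMultiplierCLM_apply,
      FourierTransform.fourier_fourierInv_eq]
  rw [← Lp.norm_fourier_eq g, ← Lp.norm_fourier_eq f]
  rw [hg]
  refine (Lp.norm_le_mul_norm_of_ae_le_mul (c := C) ?_)
  filter_upwards [Lp.coeFn_lpSMul (r := 2) (hmt.toLp m) (𝓕 f), hmt.coeFn_toLp] with x h1 h2
  rw [h1, Pi.smul_apply', h2, norm_smul]
  gcongr
  exact hC x

/-- Schwartz functions are dense in `H¹`. -/
lemma MemH1.exists_schwartz {f : L2} (hf : MemH1 f) :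
    ∃ φ : ℕ → 𝓢(Plane, ℂ), Tendsto (fun n => toL2 (φ n)) atTop (𝓝 f) ∧
      ∀ j, Tendsto (fun n => toL2 (∂_{e j} (φ n))) atTop (𝓝 (weakPartial j f)) := by
  -- Here `f` is the Bessel potential of order one of `F ∈ L²`. Schwartz approximations of `F` are
  -- mapped to Schwartz approximations of `f`, and both required convergences reduce to bounded
  -- multipliers acting on `ψ n - F`.
  obtain ⟨F, hF⟩ := hf
  have hd : DenseRange (SchwartzMap.toLpCLM ℂ (E := Plane) ℂ 2 volume) :=
    SchwartzMap.denseRange_toLpCLM ENNReal.ofNat_ne_top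
  obtain ⟨s, hs, hsF⟩ := mem_closure_iff_seq_limit.1 (hd F)
  choose ψ hψ using hs
  have hψF : Tendsto (fun n => toL2 (ψ n)) atTop (𝓝 F) := by
    refine hsF.congr fun n => ?_
    rw [← hψ n]; rfl
  set m : Plane → ℂ := fun x => ((1 + ‖x‖ ^ 2) ^ (-1 / 2 : ℝ) : ℝ) with hm
  have hmg : m.HasTemperateGrowth := by fun_prop
  have hmC : ∀ x, ‖m x‖ ≤ 1 := fun x => by
    rw [hm, Complex.norm_real, Real.norm_of_nonneg (by positivity)]
    exact Real.rpow_le_one_of_one_le_of_nonpos (by simp) (by norm_num)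
  let φ : ℕ → 𝓢(Plane, ℂ) := fun n => SchwartzMap.fourierMultiplierCLM ℂ m (ψ n)
  have hφ : ∀ n, ((toL2 (φ n) : L2) : 𝓢'(Plane, ℂ)) =
      fourierMultiplierCLM ℂ m ((toL2 (ψ n) : L2) : 𝓢'(Plane, ℂ)) := fun n => by
    rw [Lp.toTemperedDistribution_toLp_eq, Lp.toTemperedDistribution_toLp_eq,
      fourierMultiplierCLM_toTemperedDistributionCLM_eq hmg]
  have hfF : (f : 𝓢'(Plane, ℂ)) = fourierMultiplierCLM ℂ m (F : 𝓢'(Plane, ℂ)) := by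
    have := (besselPotential_neg_apply_eq_iff 1 (F : 𝓢'(Plane, ℂ)) (f : 𝓢'(Plane, ℂ))).2 hF
    rw [← this, besselPotential]
  have hdiff : ∀ n, fourierMultiplierCLM ℂ m ((toL2 (ψ n) - F : L2) : 𝓢'(Plane, ℂ)) =
      ((toL2 (φ n) - f : L2) : 𝓢'(Plane, ℂ)) := fun n => by
    rw [toTemperedDistribution_sub, toTemperedDistribution_sub, map_sub, hφ, hfF]
  have hψ0 : Tendsto (fun n => ‖toL2 (ψ n) - F‖) atTop (𝓝 0) :=
    tendsto_iff_norm_sub_tendsto_zero.1 hψF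
  refine ⟨φ, ?_, fun j => ?_⟩
  · rw [tendsto_iff_norm_sub_tendsto_zero]
    refine squeeze_zero (fun _ => norm_nonneg _) (fun n => ?_) hψ0
    simpa using norm_le_of_fourierMultiplierCLM_eq hmg hmC (hdiff n)
  · rw [tendsto_iff_norm_sub_tendsto_zero]
    set μ : Plane → ℂ := fun x => (2 * Real.pi * Complex.I) * ((inner ℝ x (e j) : ℝ) : ℂ) with hμ
    have hμg : μ.HasTemperateGrowth := by fun_prop
    have hder : ∀ T : 𝓢'(Plane, ℂ), ∂_{e j} T = fourierMultiplierCLM ℂ μ T := fun T => by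
      rw [TemperedDistribution.lineDeriv_eq_fourierMultiplierCLM,
        show μ = (2 * Real.pi * Complex.I) • fun x : Plane => ((inner ℝ x (e j) : ℝ) : ℂ) from rfl,
        fourierMultiplierCLM_smul (by fun_prop)]
      rfl
    -- The Bessel factor compensates the growth of the symbol of `∂ⱼ`.
    have hmμC : ∀ x, ‖(m * μ) x‖ ≤ 2 * Real.pi := fun x => by
      have hp := Real.pi_pos
      have h1 : |inner ℝ x (e j)| ≤ ‖x‖ := by
        simpa [norm_e] using abs_real_inner_le_norm x (e j)
      have h2 : ‖x‖ ≤ (1 + ‖x‖ ^ 2) ^ (1 / 2 : ℝ) := by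
        rw [← Real.sqrt_eq_rpow]
        exact Real.le_sqrt_of_sq_le (by simp)
      have h3 : (1 + ‖x‖ ^ 2) ^ (-1 / 2 : ℝ) * (1 + ‖x‖ ^ 2) ^ (1 / 2 : ℝ) = 1 := by
        rw [← Real.rpow_add (by positivity)]
        norm_num
      have h4 : ‖(m * μ) x‖ =
          (1 + ‖x‖ ^ 2) ^ (-1 / 2 : ℝ) * (2 * Real.pi * |inner ℝ x (e j)|) := by
        rw [Pi.mul_apply, norm_mul, hm, hμ, Complex.norm_real,
          Real.norm_of_nonneg (by positivity), norm_mul, Complex.norm_real]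
        simp [abs_of_pos hp]
      rw [h4]
      calc (1 + ‖x‖ ^ 2) ^ (-1 / 2 : ℝ) * (2 * Real.pi * |inner ℝ x (e j)|)
          ≤ (1 + ‖x‖ ^ 2) ^ (-1 / 2 : ℝ) * (2 * Real.pi * (1 + ‖x‖ ^ 2) ^ (1 / 2 : ℝ)) := by
            gcongr
            exact h1.trans h2
        _ = 2 * Real.pi := by rw [mul_left_comm, h3, mul_one]
    have hd2 : ∀ n, fourierMultiplierCLM ℂ (m * μ) ((toL2 (ψ n) - F : L2) : 𝓢'(Plane, ℂ)) =
        ((toL2 (∂_{e j} (φ n)) - weakPartial j f : L2) : 𝓢'(Plane, ℂ)) := fun n => by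
      rw [← fourierMultiplierCLM_fourierMultiplierCLM_apply hmg hμg, hdiff, ← hder]
      have h1 := hasWeakPartial_toLp (φ n) j
      have h2 := ((MemH1.hasWeakPartial (f := f) ⟨F, hF⟩ j).smul (-1))
      have h3 := h1.add h2
      simp only [neg_smul, one_smul, ← sub_eq_add_neg] at h3
      exact h3
    have hmμg : (m * μ).HasTemperateGrowth := hmg.mul hμg
    refine squeeze_zero (fun _ => norm_nonneg _)
      (fun n => norm_le_of_fourierMultiplierCLM_eq hmμg hmμC (hd2 n)) ?_
    simpa using hψ0.const_mul (2 * Real.pi)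

/-! ### Bounded multiplication operators and integration by parts -/

/-- A bounded measurable multiplier. -/
structure Multiplier (k : Plane → ℂ) (C : ℝ) : Prop where
  meas : AEStronglyMeasurable k (volume : Measure Plane)
  bound : ∀ x, ‖k x‖ ≤ C

namespace Multiplier

variable {k : Plane → ℂ} {C : ℝ}

lemma nonneg (h : Multiplier k C) : 0 ≤ C := (norm_nonneg _).trans (h.bound 0)

lemma memLp (h : Multiplier k C) (f : L2) :
    MemLp (fun x => k x * f x) 2 (volume : Measure Plane) := by
  refine (Lp.memLp f).of_le_mul (c := C) (h.meas.mul (Lp.aestronglyMeasurable f)) ?_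
  refine ae_of_all _ fun x => ?_
  rw [norm_mul]
  gcongr
  exact h.bound x

lemma coeFn_mulL2 (h : Multiplier k C) (f : L2) : mulL2 k f =ᵐ[volume] fun x => k x * f x := by
  rw [mulL2, dif_pos (h.memLp f)]
  exact (h.memLp f).coeFn_toLp

lemma norm_mulL2_le (h : Multiplier k C) (f : L2) : ‖mulL2 k f‖ ≤ C * ‖f‖ := by
  refine Lp.norm_le_mul_norm_of_ae_le_mul ?_
  filter_upwards [h.coeFn_mulL2 f] with x hx
  rw [hx, norm_mul]
  gcongr
  exact h.bound x

lemma mulL2_add (h : Multiplier k C) (f g : L2) : mulL2 k (f + g) = mulL2 k f + mulL2 k g := by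
  refine Lp.ext ?_
  filter_upwards [h.coeFn_mulL2 f, h.coeFn_mulL2 g, h.coeFn_mulL2 (f + g), Lp.coeFn_add f g,
    Lp.coeFn_add (mulL2 k f) (mulL2 k g)] with x h1 h2 h3 h4 h5
  rw [h3, h5, Pi.add_apply, h1, h2, h4, Pi.add_apply, mul_add]

lemma mulL2_smul (h : Multiplier k C) (c : ℂ) (f : L2) : mulL2 k (c • f) = c • mulL2 k f := by
  refine Lp.ext ?_
  filter_upwards [h.coeFn_mulL2 f, h.coeFn_mulL2 (c • f), Lp.coeFn_smul c f,
    Lp.coeFn_smul c (mulL2 k f)] with x h1 h2 h3 h4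
  rw [h2, h4, Pi.smul_apply, h1, h3, Pi.smul_apply, smul_eq_mul, smul_eq_mul, mul_left_comm]

lemma mulL2_sub (h : Multiplier k C) (f g : L2) : mulL2 k (f - g) = mulL2 k f - mulL2 k g := by
  have := h.mulL2_add f ((-1 : ℂ) • g)
  rw [h.mulL2_smul] at this
  simpa only [neg_smul, one_smul, ← sub_eq_add_neg] using this

lemma tendsto_mulL2 (h : Multiplier k C) {ι : Type*} {l : Filter ι} {f : ι → L2} {g : L2}
    (hf : Tendsto f l (𝓝 g)) : Tendsto (fun i => mulL2 k (f i)) l (𝓝 (mulL2 k g)) := by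
  rw [tendsto_iff_norm_sub_tendsto_zero] at hf ⊢
  refine squeeze_zero (fun _ => norm_nonneg _) (fun i => ?_) (by simpa using hf.const_mul C)
  rw [← h.mulL2_sub]
  exact h.norm_mulL2_le _

lemma inner_mulL2 (h : Multiplier k C) (f g : L2) :
    ⟪f, mulL2 k g⟫_ℂ = ∫ x, k x * ((starRingEnd ℂ) (f x) * g x) := by
  rw [L2.inner_def]
  refine integral_congr_ae ?_
  filter_upwards [h.coeFn_mulL2 g] with x hx
  rw [hx, RCLike.inner_apply]
  ring

lemma inner_mulL2_left (h : Multiplier k C) (f g : L2) :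
    ⟪mulL2 k f, g⟫_ℂ = ∫ x, (starRingEnd ℂ) (k x) * ((starRingEnd ℂ) (f x) * g x) := by
  rw [L2.inner_def]
  refine integral_congr_ae ?_
  filter_upwards [h.coeFn_mulL2 f] with x hx
  rw [hx, RCLike.inner_apply, map_mul]
  ring

lemma inner_mulL2_comm (h : Multiplier k C) (hk : ∀ x, (starRingEnd ℂ) (k x) = k x) (f g : L2) :
    ⟪mulL2 k f, g⟫_ℂ = ⟪f, mulL2 k g⟫_ℂ := by
  rw [h.inner_mulL2, h.inner_mulL2_left]
  simp only [hk]

lemma tendsto_integral (h : Multiplier k C) {ι : Type*} {l : Filter ι} {f g : ι → L2} {f' g' : L2}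
    (hf : Tendsto f l (𝓝 f')) (hg : Tendsto g l (𝓝 g')) :
    Tendsto (fun i => ∫ x, k x * ((starRingEnd ℂ) (f i x) * g i x)) l
      (𝓝 (∫ x, k x * ((starRingEnd ℂ) (f' x) * g' x))) := by
  simp only [← h.inner_mulL2]
  exact hf.inner (h.tendsto_mulL2 hg)

lemma norm_integral_le (h : Multiplier k C) (f g : L2) :
    ‖∫ x, k x * ((starRingEnd ℂ) (f x) * g x)‖ ≤ C * (‖f‖ * ‖g‖) := by
  rw [← h.inner_mulL2]
  refine (norm_inner_le_norm _ _).trans ?_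
  rw [mul_left_comm]
  gcongr
  exact h.norm_mulL2_le g

end Multiplier

lemma integrable_conj_mul (f g : L2) :
    Integrable fun x => (starRingEnd ℂ) (f x) * g x := by
  have := L2.integrable_inner (𝕜 := ℂ) f g
  simpa only [RCLike.inner_apply, mul_comm] using this

lemma multiplier_schwartz (φ : 𝓢(Plane, ℂ)) : ∃ C, Multiplier φ C := by
  refine ⟨SchwartzMap.seminorm ℂ 0 0 φ, φ.continuous.aestronglyMeasurable, fun x => ?_⟩
  exact SchwartzMap.norm_le_seminorm ℂ φ x

/-- The complex conjugate of a Schwartz function. -/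
noncomputable def schwartzConj (φ : 𝓢(Plane, ℂ)) : 𝓢(Plane, ℂ) :=
  SchwartzMap.postcompCLM (𝕜 := ℝ) (Complex.conjCLE : ℂ →L[ℝ] ℂ) φ

lemma schwartzConj_apply (φ : 𝓢(Plane, ℂ)) (x : Plane) :
    schwartzConj φ x = (starRingEnd ℂ) (φ x) := rfl

lemma lineDerivOp_schwartzConj (φ : 𝓢(Plane, ℂ)) (v x : Plane) :
    (∂_{v} (schwartzConj φ)) x = (starRingEnd ℂ) ((∂_{v} φ) x) := by
  rw [SchwartzMap.lineDerivOp_apply_eq_fderiv, SchwartzMap.lineDerivOp_apply_eq_fderiv]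
  have := (Complex.conjCLE : ℂ →L[ℝ] ℂ).hasFDerivAt.comp x (φ.hasFDerivAt x)
  rw [show (schwartzConj φ : Plane → ℂ) = (Complex.conjCLE : ℂ →L[ℝ] ℂ) ∘ φ from rfl,
    this.fderiv]
  rfl

lemma HasWeakPartial.inner_toLp {j : Fin 2} {f g : L2} (h : HasWeakPartial j f g)
    (φ : 𝓢(Plane, ℂ)) :
    ⟪g, toL2 φ⟫_ℂ = -⟪f, toL2 (∂_{e j} φ)⟫_ℂ := by
  have key : ∀ (f : L2) (φ : 𝓢(Plane, ℂ)),
      ⟪f, toL2 φ⟫_ℂ = (starRingEnd ℂ) (∫ x, schwartzConj φ x * f x) := fun f φ => by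
    rw [L2.inner_def, ← integral_conj]
    refine integral_congr_ae ?_
    filter_upwards [φ.coeFn_toLp 2 volume] with x hx
    rw [RCLike.inner_apply, hx, map_mul, schwartzConj_apply, Complex.conj_conj]
  rw [key, key, hasWeakPartial_iff.1 h, map_neg]
  congr 4 with x
  rw [lineDerivOp_schwartzConj, schwartzConj_apply]

/-- Integration by parts. -/
lemma HasWeakPartial.inner_eq {j : Fin 2} {f f' g : L2} (h : HasWeakPartial j f f')
    (hg : MemH1 g) : ⟪f', g⟫_ℂ = -⟪f, weakPartial j g⟫_ℂ := by
  obtain ⟨φ, h1, h2⟩ := hg.exists_schwartz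
  refine tendsto_nhds_unique (tendsto_const_nhds.inner h1) ?_
  refine ((tendsto_const_nhds.inner (h2 j)).neg).congr fun n => ?_
  rw [h.inner_toLp]

/-- One integration by parts. This interpolation turns the squared gradient of an increment into its
`L²` norm times its `H²` norm, as the energy expansion requires. -/
lemma norm_weakPartial_sq_le {f : L2} (hf : MemH2 f) (j : Fin 2) :
    ‖weakPartial j f‖ ^ 2 ≤ ‖weakPartial j (weakPartial j f)‖ * ‖f‖ := by
  have h := (((hf.memH1_weakPartial j).hasWeakPartial j).inner_eq hf.memH1)
  have h2 : (‖weakPartial j f‖ ^ 2 : ℝ) = ‖⟪weakPartial j f, weakPartial j f⟫_ℂ‖ := by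
    rw [inner_self_eq_norm_sq_to_K]; simp
  rw [h2, ← norm_neg, ← h]
  exact norm_inner_le_norm _ _

end CSS

namespace CSS

open scoped ENNReal InnerProductSpace

/-! ### The Hardy-type inequality -/

lemma schwartz_integral_mul_lineDeriv {k k' : Plane → ℂ} {C C' : ℝ} {j : Fin 2}
    (hk : Multiplier k C) (hk' : Multiplier k' C') (hd : Differentiable ℝ k)
    (hkk' : ∀ x, fderiv ℝ k x (e j) = k' x) (φ ψ : 𝓢(Plane, ℂ)) :
    (∫ x, k x * ((starRingEnd ℂ) (toL2 (∂_{e j} φ) x) * toL2 ψ x)) +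
      ∫ x, k x * ((starRingEnd ℂ) (toL2 φ x) * toL2 (∂_{e j} ψ) x) =
    -∫ x, k' x * ((starRingEnd ℂ) (toL2 φ x) * toL2 ψ x) := by
  set g : Plane → ℂ := fun x => (starRingEnd ℂ) (φ x) * ψ x with hg
  have hgd : ∀ x, HasFDerivAt g (schwartzConj φ x • fderiv ℝ ψ x + ψ x • fderiv ℝ (schwartzConj φ) x)
      x := fun x => ((schwartzConj φ).hasFDerivAt x).mul (ψ.hasFDerivAt x)
  have hgd' : ∀ x, fderiv ℝ g x (e j) =
      (starRingEnd ℂ) ((∂_{e j} φ) x) * ψ x + (starRingEnd ℂ) (φ x) * (∂_{e j} ψ) x := fun x => by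
    rw [(hgd x).fderiv, ← lineDerivOp_schwartzConj, SchwartzMap.lineDerivOp_apply_eq_fderiv,
      SchwartzMap.lineDerivOp_apply_eq_fderiv, ← schwartzConj_apply]
    simp only [add_apply, smul_apply, smul_eq_mul]
    ring
  have ae : ∀ φ ψ : 𝓢(Plane, ℂ), (fun x => (starRingEnd ℂ) (toL2 φ x) * toL2 ψ x) =ᵐ[volume]
      fun x => (starRingEnd ℂ) (φ x) * ψ x := fun φ ψ => by
    filter_upwards [φ.coeFn_toLp 2 volume, ψ.coeFn_toLp 2 volume] with x h1 h2
    rw [h1, h2]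
  have hint : ∀ (φ ψ : 𝓢(Plane, ℂ)), Integrable fun x => (starRingEnd ℂ) (φ x) * ψ x :=
    fun φ ψ => (integrable_conj_mul (toL2 φ) (toL2 ψ)).congr (ae φ ψ)
  have hmul : ∀ {k : Plane → ℂ} {C : ℝ}, Multiplier k C → ∀ {g : Plane → ℂ}, Integrable g →
      Integrable fun x => k x * g x := fun hk g hg =>
    hg.bdd_mul hk.meas (ae_of_all _ hk.bound)
  have haem : ∀ (k : Plane → ℂ) (φ ψ : 𝓢(Plane, ℂ)),
      ∫ x, k x * ((starRingEnd ℂ) (toL2 φ x) * toL2 ψ x) =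
      ∫ x, k x * ((starRingEnd ℂ) (φ x) * ψ x) := fun k φ ψ => by
    refine integral_congr_ae ?_
    filter_upwards [ae φ ψ] with x hx
    rw [hx]
  rw [haem, haem, haem, ← integral_add (hmul hk (hint _ _)) (hmul hk (hint _ _))]
  have hibp := integral_mul_fderiv_eq_neg_fderiv_mul_of_integrable (μ := (volume : Measure Plane))
    (f := k) (g := g) (v := e j) ?_ ?_ (hmul hk (hint φ ψ)) (fun x _ => hd x)
    (fun x _ => (hgd x).differentiableAt)
  · simp only [hgd', hkk', mul_add] at hibp
    exact hibp
  · simp only [hkk']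
    exact hmul hk' (hint φ ψ)
  · simp only [hgd']
    exact hmul hk ((hint _ _).add (hint _ _))

/-- With `k` and `k'` bounded, every term is continuous in the `L²` data `f, ∂ⱼf, g, ∂ⱼg`, so the
identity passes from Schwartz functions to `H¹` by density. -/
lemma MemH1.integral_mul_weakPartial {k k' : Plane → ℂ} {C C' : ℝ} {j : Fin 2}
    (hk : Multiplier k C) (hk' : Multiplier k' C') (hd : Differentiable ℝ k)
    (hkk' : ∀ x, fderiv ℝ k x (e j) = k' x) {f g : L2} (hf : MemH1 f) (hg : MemH1 g) :
    (∫ x, k x * ((starRingEnd ℂ) (weakPartial j f x) * g x)) +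
      ∫ x, k x * ((starRingEnd ℂ) (f x) * weakPartial j g x) =
    -∫ x, k' x * ((starRingEnd ℂ) (f x) * g x) := by
  obtain ⟨φ, h1, h2⟩ := hf.exists_schwartz
  obtain ⟨ψ, h3, h4⟩ := hg.exists_schwartz
  refine tendsto_nhds_unique
    ((hk.tendsto_integral (h2 j) h3).add (hk.tendsto_integral h1 (h4 j))) ?_
  refine ((hk'.tendsto_integral h1 h3).neg).congr fun n => ?_
  rw [schwartz_integral_mul_lineDeriv hk hk' hd hkk']

/-- The regularised radial unit field. -/
noncomputable def radialField (x : Plane) (ε : ℝ) (j : Fin 2) (y : Plane) : ℝ :=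
  (y j - x j) * (√(‖y - x‖ ^ 2 + ε))⁻¹

/-- The derivative of `radialField x ε j` in the `j`-th direction. -/
noncomputable def radialFieldDeriv (x : Plane) (ε : ℝ) (j : Fin 2) (y : Plane) : ℝ :=
  (√(‖y - x‖ ^ 2 + ε))⁻¹ - (y j - x j) ^ 2 * (√(‖y - x‖ ^ 2 + ε))⁻¹ ^ 3

section

variable {x : Plane} {ε : ℝ} {j : Fin 2}

lemma hasFDerivAt_radialField (hε : 0 < ε) (y : Plane) :
    ∃ L : Plane →L[ℝ] ℝ, HasFDerivAt (radialField x ε j) L y ∧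
      L (e j) = radialFieldDeriv x ε j y := by
  have hpos : 0 < ‖y - x‖ ^ 2 + ε := by positivity
  have hs0 : √(‖y - x‖ ^ 2 + ε) ≠ 0 := (Real.sqrt_pos.2 hpos).ne'
  have h1 : HasFDerivAt (fun y : Plane => ‖y - x‖ ^ 2 + ε) _ y :=
    (((hasFDerivAt_id y).sub_const x).norm_sq).add_const ε
  have h2 := (hasDerivAt_inv hs0).comp_hasFDerivAt y (h1.sqrt hpos.ne')
  have h3 : HasFDerivAt (fun y : Plane => y j - x j) (EuclideanSpace.proj (𝕜 := ℝ) j) y :=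
    ((EuclideanSpace.proj (𝕜 := ℝ) j).hasFDerivAt (x := y)).sub_const _
  refine ⟨_, h3.mul h2, ?_⟩
  have hin : ∀ z : Plane, ⟪z, e j⟫_ℝ = z j := fun z => by
    simp [e, EuclideanSpace.inner_single_right]
  have hej : (e j) j = 1 := by simp [e]
  simp [radialFieldDeriv, hin, hej]
  field_simp
  ring

lemma abs_coord_le_sqrt (hε : 0 < ε) (y : Plane) : |y j - x j| ≤ √(‖y - x‖ ^ 2 + ε) := by
  refine Real.le_sqrt_of_sq_le ?_
  have h := PiLp.norm_apply_le (y - x) j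
  rw [PiLp.sub_apply, Real.norm_eq_abs] at h
  have := pow_le_pow_left₀ (abs_nonneg _) h 2
  linarith

lemma abs_radialField_le (hε : 0 < ε) (y : Plane) : |radialField x ε j y| ≤ 1 := by
  have hpos : 0 < √(‖y - x‖ ^ 2 + ε) := Real.sqrt_pos.2 (by positivity)
  rw [radialField, abs_mul, abs_of_pos (inv_pos.2 hpos), mul_inv_le_iff₀ hpos, one_mul]
  exact abs_coord_le_sqrt hε y

lemma abs_radialFieldDeriv_le (hε : 0 < ε) (y : Plane) :
    |radialFieldDeriv x ε j y| ≤ (√ε)⁻¹ := by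
  have hpos : 0 < √(‖y - x‖ ^ 2 + ε) := Real.sqrt_pos.2 (by positivity)
  have h1 : (√(‖y - x‖ ^ 2 + ε))⁻¹ ≤ (√ε)⁻¹ := by
    refine inv_anti₀ (Real.sqrt_pos.2 hε) (Real.sqrt_le_sqrt ?_)
    simp
  have h2 : radialFieldDeriv x ε j y =
      (√(‖y - x‖ ^ 2 + ε))⁻¹ * (1 - (radialField x ε j y) ^ 2) := by
    simp only [radialFieldDeriv, radialField]; ring
  have h3 : radialField x ε j y ^ 2 ≤ 1 := by
    rw [sq_le_one_iff_abs_le_one]; exact abs_radialField_le hε y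
  rw [h2, abs_mul, abs_of_pos (inv_pos.2 hpos), abs_of_nonneg (by linarith)]
  calc (√(‖y - x‖ ^ 2 + ε))⁻¹ * (1 - radialField x ε j y ^ 2)
      ≤ (√(‖y - x‖ ^ 2 + ε))⁻¹ * 1 := by
        gcongr
        linarith [sq_nonneg (radialField x ε j y)]
    _ ≤ (√ε)⁻¹ := by rwa [mul_one]

/-- With `r² = |y - x|² + ε`, the divergence is `2/r - |y - x|²/r³`, which is at least `1/r`. -/
lemma inv_sqrt_le_sum_radialFieldDeriv (hε : 0 < ε) (y : Plane) :
    (√(‖y - x‖ ^ 2 + ε))⁻¹ ≤ ∑ j, radialFieldDeriv x ε j y := by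
  have hpos : 0 < √(‖y - x‖ ^ 2 + ε) := Real.sqrt_pos.2 (by positivity)
  have h1 : (y 0 - x 0) ^ 2 + (y 1 - x 1) ^ 2 = ‖y - x‖ ^ 2 := by
    rw [EuclideanSpace.norm_sq_eq]; simp
  have h2 : √(‖y - x‖ ^ 2 + ε) ^ 2 = ‖y - x‖ ^ 2 + ε := Real.sq_sqrt (by positivity)
  rw [Fin.sum_univ_two, radialFieldDeriv, radialFieldDeriv]
  set r := √(‖y - x‖ ^ 2 + ε)
  have h3 : r⁻¹ ^ 3 * r ^ 2 = r⁻¹ := by field_simp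
  have h4 : ((y 0 - x 0) ^ 2 + (y 1 - x 1) ^ 2) * r⁻¹ ^ 3 ≤ r⁻¹ := by
    calc ((y 0 - x 0) ^ 2 + (y 1 - x 1) ^ 2) * r⁻¹ ^ 3 ≤ r ^ 2 * r⁻¹ ^ 3 := by
          gcongr
          linarith
      _ = r⁻¹ := by rw [mul_comm, h3]
  linarith

lemma continuous_inv_sqrt (hε : 0 < ε) :
    Continuous fun y : Plane => (√(‖y - x‖ ^ 2 + ε))⁻¹ := by
  refine Continuous.inv₀ (by fun_prop) fun y => ?_
  exact (Real.sqrt_pos.2 (by positivity)).ne'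

lemma multiplier_radialField (hε : 0 < ε) :
    Multiplier (fun y => (radialField x ε j y : ℂ)) 1 := by
  refine ⟨?_, fun y => ?_⟩
  · have := continuous_inv_sqrt (x := x) hε
    have : Continuous (radialField x ε j) := by unfold radialField; fun_prop
    exact (Complex.continuous_ofReal.comp this).aestronglyMeasurable
  · rw [Complex.norm_real]; exact abs_radialField_le hε y

lemma multiplier_radialFieldDeriv (hε : 0 < ε) :
    Multiplier (fun y => (radialFieldDeriv x ε j y : ℂ)) (√ε)⁻¹ := by
  refine ⟨?_, fun y => ?_⟩
  · have := continuous_inv_sqrt (x := x) hε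
    have : Continuous (radialFieldDeriv x ε j) := by unfold radialFieldDeriv; fun_prop
    exact (Complex.continuous_ofReal.comp this).aestronglyMeasurable
  · rw [Complex.norm_real]; exact abs_radialFieldDeriv_le hε y

end

lemma conj_mul_self_eq (f : L2) (x : Plane) :
    (starRingEnd ℂ) (f x) * f x = ((‖f x‖ ^ 2 : ℝ) : ℂ) := by
  rw [mul_comm, Complex.mul_conj, Complex.normSq_eq_norm_sq]

/-- Integrate the divergence of the unit radial field against `|f|²` by parts. Only `2 Re(f̄ ∂ⱼf)`
enters, so `hⱼ` may replace `∂ⱼf`, and the field is bounded by one. The parameter `ε` makes the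
field differentiable with bounded `∂ⱼ` of its `j`-th component. -/
lemma MemH1.lintegral_regularized_le {f : L2} (hf : MemH1 f) {h : Fin 2 → L2}
    (hh : ∀ j, ∀ᵐ y ∂volume,
      (starRingEnd ℂ) (weakPartial j f y) * f y + (starRingEnd ℂ) (f y) * weakPartial j f y =
      (starRingEnd ℂ) (h j y) * f y + (starRingEnd ℂ) (f y) * h j y)
    (x : Plane) {ε : ℝ} (hε : 0 < ε) :
    ∫⁻ y, ‖f y‖ₑ ^ 2 * ENNReal.ofReal (√(‖y - x‖ ^ 2 + ε))⁻¹ ≤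
      ENNReal.ofReal (2 * ‖f‖ * ∑ j, ‖h j‖) := by
  have hint : Integrable fun y => ‖f y‖ ^ 2 := (Lp.memLp f).integrable_norm_pow two_ne_zero
  have hmul : ∀ {k : Plane → ℝ} {C : ℝ}, Continuous k → (∀ y, |k y| ≤ C) →
      Integrable fun y => k y * ‖f y‖ ^ 2 := fun hk hC =>
    hint.bdd_mul hk.aestronglyMeasurable (ae_of_all _ hC)
  have hcont := continuous_inv_sqrt (x := x) hε
  have hdc : ∀ j, Continuous (radialFieldDeriv x ε j) := fun j => by
    unfold radialFieldDeriv; fun_prop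
  have hkint : Integrable fun y => (√(‖y - x‖ ^ 2 + ε))⁻¹ * ‖f y‖ ^ 2 := by
    refine hmul (C := (√ε)⁻¹) hcont fun y => ?_
    rw [abs_of_nonneg (by positivity)]
    refine inv_anti₀ (Real.sqrt_pos.2 hε) (Real.sqrt_le_sqrt ?_)
    simp
  have hdint : ∀ j, Integrable fun y => radialFieldDeriv x ε j y * ‖f y‖ ^ 2 := fun j =>
    hmul (hdc j) (abs_radialFieldDeriv_le hε)
  have hj : ∀ j, ∫ y, radialFieldDeriv x ε j y * ‖f y‖ ^ 2 ≤ 2 * ‖f‖ * ‖h j‖ := fun j => by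
    have hV := multiplier_radialField (x := x) (j := j) hε
    have hV' := multiplier_radialFieldDeriv (x := x) (j := j) hε
    have hder : ∀ y, HasFDerivAt (fun y => (radialField x ε j y : ℂ))
        (Complex.ofRealCLM.comp (hasFDerivAt_radialField (x := x) (j := j) hε y).choose) y :=
      fun y => Complex.ofRealCLM.hasFDerivAt.comp y
        (hasFDerivAt_radialField (x := x) (j := j) hε y).choose_spec.1
    have hI := hf.integral_mul_weakPartial (j := j) hV hV' (fun y => (hder y).differentiableAt)
      (fun y => by
        rw [(hder y).fderiv]
        exact congrArg Complex.ofReal (hasFDerivAt_radialField (x := x) (j := j) hε y).choose_spec.2) hf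
    have hb : ∀ f g : L2, Integrable fun y =>
        (radialField x ε j y : ℂ) * ((starRingEnd ℂ) (f y) * g y) := fun f g =>
      (integrable_conj_mul f g).bdd_mul hV.meas (ae_of_all _ hV.bound)
    rw [← integral_add (hb _ _) (hb _ _)] at hI
    have h1 : (∫ y, ((radialField x ε j y : ℂ) * ((starRingEnd ℂ) (weakPartial j f y) * f y) +
        (radialField x ε j y : ℂ) * ((starRingEnd ℂ) (f y) * weakPartial j f y))) =
        (∫ y, (radialField x ε j y : ℂ) * ((starRingEnd ℂ) (h j y) * f y)) +
        ∫ y, (radialField x ε j y : ℂ) * ((starRingEnd ℂ) (f y) * h j y) := by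
      rw [← integral_add (hb _ _) (hb _ _)]
      refine integral_congr_ae ?_
      filter_upwards [hh j] with y hy
      rw [← mul_add, hy, mul_add]
    have h2 : ∫ y, (radialFieldDeriv x ε j y : ℂ) * ((starRingEnd ℂ) (f y) * f y) =
        ((∫ y, radialFieldDeriv x ε j y * ‖f y‖ ^ 2 : ℝ) : ℂ) := by
      rw [← integral_complex_ofReal]
      simp only [conj_mul_self_eq, Complex.ofReal_mul]
    rw [h1, h2] at hI
    calc ∫ y, radialFieldDeriv x ε j y * ‖f y‖ ^ 2
        ≤ ‖((∫ y, radialFieldDeriv x ε j y * ‖f y‖ ^ 2 : ℝ) : ℂ)‖ := by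
          rw [Complex.norm_real]; exact le_abs_self _
      _ ≤ 1 * (‖h j‖ * ‖f‖) + 1 * (‖f‖ * ‖h j‖) := by
          rw [← norm_neg, ← hI]
          exact (norm_add_le _ _).trans (add_le_add (hV.norm_integral_le _ _)
            (hV.norm_integral_le _ _))
      _ = 2 * ‖f‖ * ‖h j‖ := by ring
  have hle : ∫ y, (√(‖y - x‖ ^ 2 + ε))⁻¹ * ‖f y‖ ^ 2 ≤ 2 * ‖f‖ * ∑ j, ‖h j‖ := by
    calc ∫ y, (√(‖y - x‖ ^ 2 + ε))⁻¹ * ‖f y‖ ^ 2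
        ≤ ∫ y, ∑ j, radialFieldDeriv x ε j y * ‖f y‖ ^ 2 := by
          refine integral_mono hkint (integrable_finsetSum _ fun j _ => hdint j) fun y => ?_
          simp only [← Finset.sum_mul]
          gcongr
          exact inv_sqrt_le_sum_radialFieldDeriv hε y
      _ = ∑ j, ∫ y, radialFieldDeriv x ε j y * ‖f y‖ ^ 2 :=
          integral_finsetSum _ fun j _ => hdint j
      _ ≤ 2 * ‖f‖ * ∑ j, ‖h j‖ := by
          rw [Finset.mul_sum]
          exact Finset.sum_le_sum fun j _ => hj j
  calc ∫⁻ y, ‖f y‖ₑ ^ 2 * ENNReal.ofReal (√(‖y - x‖ ^ 2 + ε))⁻¹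
      = ∫⁻ y, ENNReal.ofReal ((√(‖y - x‖ ^ 2 + ε))⁻¹ * ‖f y‖ ^ 2) := by
        congr 1 with y
        rw [ENNReal.ofReal_mul (by positivity), ENNReal.ofReal_pow (norm_nonneg _), ofReal_norm,
          mul_comm]
    _ = ENNReal.ofReal (∫ y, (√(‖y - x‖ ^ 2 + ε))⁻¹ * ‖f y‖ ^ 2) :=
        (ofReal_integral_eq_lintegral_ofReal hkint (ae_of_all _ fun y => by positivity)).symm
    _ ≤ ENNReal.ofReal (2 * ‖f‖ * ∑ j, ‖h j‖) := ENNReal.ofReal_le_ofReal hle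

/-- The Hardy-type inequality `∫ |f(y)|² / |x - y| dy ≤ 2 ‖f‖ ∑ⱼ ‖hⱼ‖` for any `hⱼ` with
`Re (f̄ hⱼ) = Re (f̄ ∂ⱼf)`. -/
lemma MemH1.hardy_le_of_re_eq {f : L2} (hf : MemH1 f) {h : Fin 2 → L2}
    (hh : ∀ j, ∀ᵐ y ∂volume,
      (starRingEnd ℂ) (weakPartial j f y) * f y + (starRingEnd ℂ) (f y) * weakPartial j f y =
      (starRingEnd ℂ) (h j y) * f y + (starRingEnd ℂ) (f y) * h j y) :
    hardy f ≤ ENNReal.ofReal (2 * ‖f‖ * ∑ j, ‖h j‖) := by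
  refine iSup_le fun x => ?_
  -- The regularisation is removed by Fatou's lemma, the right-hand side being independent of `ε`.
  set ε : ℕ → ℝ := fun n => 1 / ((n : ℝ) + 1)
  have hε : ∀ n, 0 < ε n := fun n => Nat.one_div_pos_of_nat
  set F : ℕ → Plane → ℝ≥0∞ := fun n y =>
    ‖f y‖ₑ ^ 2 * ENNReal.ofReal (√(‖y - x‖ ^ 2 + ε n))⁻¹
  have hF : ∀ n, AEMeasurable (F n) volume := fun n => by
    refine ((Lp.aestronglyMeasurable f).enorm.pow_const 2).mul ?_
    exact (ENNReal.measurable_ofReal.comp (continuous_inv_sqrt (hε n)).measurable).aemeasurable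
  have hlim : ∀ᵐ y ∂(volume : Measure Plane),
      liminf (fun n => F n y) atTop = ‖f y‖ₑ ^ 2 * ‖x - y‖ₑ⁻¹ := by
    have hne : ∀ᵐ y ∂(volume : Measure Plane), y ≠ x := by simp [ae_iff]
    filter_upwards [hne] with y hy
    have hpos : 0 < ‖y - x‖ := norm_pos_iff.2 (sub_ne_zero.2 hy)
    refine Tendsto.liminf_eq (ENNReal.Tendsto.const_mul ?_ (Or.inr (by simp)))
    have h1 : ‖x - y‖ₑ⁻¹ = ENNReal.ofReal (√(‖y - x‖ ^ 2 + 0))⁻¹ := by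
      rw [add_zero, Real.sqrt_sq hpos.le, ENNReal.ofReal_inv_of_pos hpos, ofReal_norm,
        ← enorm_neg, neg_sub]
    rw [h1]
    refine ENNReal.tendsto_ofReal (Tendsto.inv₀ ?_ ?_)
    · exact (Real.continuous_sqrt.tendsto _).comp
        (tendsto_const_nhds.add tendsto_one_div_add_atTop_nhds_zero_nat)
    · rw [add_zero, Real.sqrt_sq hpos.le]; exact hpos.ne'
  calc ∫⁻ y, ‖f y‖ₑ ^ 2 * ‖x - y‖ₑ⁻¹ = ∫⁻ y, liminf (fun n => F n y) atTop :=
        lintegral_congr_ae (hlim.mono fun y hy => hy.symm)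
    _ ≤ liminf (fun n => ∫⁻ y, F n y) atTop := lintegral_liminf_le' hF
    _ ≤ liminf (fun _ : ℕ => ENNReal.ofReal (2 * ‖f‖ * ∑ j, ‖h j‖)) atTop :=
        liminf_le_liminf (Eventually.of_forall fun n => hf.lintegral_regularized_le hh x (hε n))
    _ = ENNReal.ofReal (2 * ‖f‖ * ∑ j, ‖h j‖) := liminf_const _

lemma MemH1.hardy_le {f : L2} (hf : MemH1 f) :
    hardy f ≤ ENNReal.ofReal (2 * ‖f‖ * ∑ j, ‖weakPartial j f‖) :=
  hf.hardy_le_of_re_eq fun _ => ae_of_all _ fun _ => rfl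

lemma MemH1.hardy_ne_top {f : L2} (hf : MemH1 f) : hardy f ≠ ∞ :=
  (hf.hardy_le.trans_lt ENNReal.ofReal_lt_top).ne

end CSS

namespace CSS

open scoped ENNReal InnerProductSpace

/-! ### Sesquilinear densities and the derivative of the vector potential -/

/-- The density `f̄ g`. -/
noncomputable def dens (f g : L2) (x : Plane) : ℂ := (starRingEnd ℂ) (f x) * g x

/-- The density `∂ⱼ(f̄ g)`. -/
noncomputable def derivDens (j : Fin 2) (f g : L2) (x : Plane) : ℂ :=
  dens (weakPartial j f) g x + dens f (weakPartial j g) x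

lemma integrable_dens (f g : L2) : Integrable (dens f g) := integrable_conj_mul f g

lemma norm_dens_le (f g : L2) : ∀ᵐ y ∂(volume : Measure Plane), ‖dens f g y‖ ≤ ‖f y‖ * ‖g y‖ :=
  ae_of_all _ fun y => by simp [dens]

lemma riesz_dens_ne_top {f g : L2} (hf : hardy f ≠ ∞) (hg : hardy g ≠ ∞) :
    riesz (dens f g) ≠ ∞ :=
  riesz_ne_top (Lp.aestronglyMeasurable f) (Lp.aestronglyMeasurable g) (norm_dens_le f g) hf hg

lemma integrable_derivDens (j : Fin 2) (f g : L2) : Integrable (derivDens j f g) :=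
  (integrable_dens _ _).add (integrable_dens _ _)

lemma riesz_add_ne_top {σ τ : Plane → ℂ} (hσ : AEStronglyMeasurable σ volume) (h : riesz σ ≠ ∞)
    (h' : riesz τ ≠ ∞) : riesz (fun y => σ y + τ y) ≠ ∞ :=
  ((riesz_add_le hσ).trans_lt (ENNReal.add_lt_top.2 ⟨h.lt_top, h'.lt_top⟩)).ne

lemma riesz_derivDens_ne_top (j : Fin 2) {f g : L2} (hf : MemH2 f) (hg : MemH2 g) :
    riesz (derivDens j f g) ≠ ∞ :=
  riesz_add_ne_top (integrable_dens _ _).1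
    (riesz_dens_ne_top (hf.memH1_weakPartial j).hardy_ne_top hg.memH1.hardy_ne_top)
    (riesz_dens_ne_top hf.memH1.hardy_ne_top (hg.memH1_weakPartial j).hardy_ne_top)

lemma multiplier_conv {R : ℝ} (hR : 0 ≤ R) (j : Fin 2) {σ : Plane → ℂ}
    (hσ : AEStronglyMeasurable σ volume) (h : riesz σ ≠ ∞) :
    Multiplier (conv R j σ) (36 * (riesz σ).toReal) :=
  ⟨aestronglyMeasurable_conv R j hσ, norm_conv_le hR j h⟩

/-- Placing the translation on `σ` keeps derivatives off the singular kernel. Continuity of `σ`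
supplies joint measurability of `σ (x - z)`. -/
lemma integral_conv_mul_eq_shift {R : ℝ} (hR : 0 ≤ R) (k : Fin 2) {σ τ : Plane → ℂ}
    (hσ : Continuous σ) (h : riesz σ ≠ ∞) (hτ : Integrable τ) :
    ∫ x, conv R k σ x * τ x =
      ∫ z, (perpGrad (w R) z k : ℂ) * ∫ x, σ (x - z) * τ x := by
  have hshift : ∀ (x : Plane) (F : Plane → Plane → ℂ),
      ∫ z, F z (x - z) = ∫ y, F (x - y) y := fun x F => by
    rw [← integral_sub_left_eq_self (fun z => F z (x - z)) volume x]
    simp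
  have hint : Integrable (fun p : Plane × Plane =>
      (perpGrad (w R) p.2 k : ℂ) * (σ (p.1 - p.2) * τ p.1))
      ((volume : Measure Plane).prod volume) := by
    have hm : AEStronglyMeasurable (fun p : Plane × Plane =>
        (perpGrad (w R) p.2 k : ℂ) * (σ (p.1 - p.2) * τ p.1))
        ((volume : Measure Plane).prod volume) := by
      refine AEStronglyMeasurable.mul ?_ (AEStronglyMeasurable.mul ?_ hτ.1.comp_fst)
      · exact ((measurable_perpGrad_w_ofReal R k).comp measurable_snd).aestronglyMeasurable
      · exact (hσ.comp (by fun_prop)).aestronglyMeasurable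
    refine ⟨hm, ?_⟩
    rw [hasFiniteIntegral_iff_enorm, lintegral_prod _ hm.enorm]
    calc ∫⁻ x, ∫⁻ z, ‖(perpGrad (w R) z k : ℂ) * (σ (x - z) * τ x)‖ₑ
        ≤ ∫⁻ x, 36 * riesz σ * ‖τ x‖ₑ := by
          refine lintegral_mono fun x => ?_
          simp only [← mul_assoc, enorm_mul _ (τ x)]
          rw [lintegral_mul_const' _ _ (by simp),
            ← lintegral_sub_left_eq_self _ (x : Plane)]
          simp only [sub_sub_cancel]
          gcongr
          exact lintegral_conv_le hR k σ x
      _ = 36 * riesz σ * ∫⁻ x, ‖τ x‖ₑ :=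
          lintegral_const_mul' _ _ (ENNReal.mul_lt_top (by simp) h.lt_top).ne
      _ < ∞ := ENNReal.mul_lt_top (ENNReal.mul_lt_top (by simp) h.lt_top) hτ.2
  calc ∫ x, conv R k σ x * τ x
      = ∫ x, ∫ z, (perpGrad (w R) z k : ℂ) * (σ (x - z) * τ x) := by
        congr 1 with x
        rw [hshift x fun z y => (perpGrad (w R) z k : ℂ) * (σ y * τ x), conv,
          ← integral_mul_const]
        simp only [mul_assoc]
    _ = ∫ z, ∫ x, (perpGrad (w R) z k : ℂ) * (σ (x - z) * τ x) := integral_integral_swap hint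
    _ = _ := by simp only [integral_const_mul]

lemma weakPartial_toL2 (φ : 𝓢(Plane, ℂ)) (j : Fin 2) :
    weakPartial j (toL2 φ) = toL2 (∂_{e j} φ) := (hasWeakPartial_toLp φ j).weakPartial_eq

lemma integral_mul_derivDens {k : Plane → ℂ} {C : ℝ} (hk : Multiplier k C) (j : Fin 2) (p q : L2) :
    ∫ x, k x * derivDens j p q x =
      (∫ x, k x * ((starRingEnd ℂ) (weakPartial j p x) * q x)) +
        ∫ x, k x * ((starRingEnd ℂ) (p x) * weakPartial j q x) := by
  rw [← integral_add ((integrable_conj_mul _ _).bdd_mul hk.meas (ae_of_all _ hk.bound))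
    ((integrable_conj_mul _ _).bdd_mul hk.meas (ae_of_all _ hk.bound))]
  simp only [derivDens, dens, mul_add]

/-- For each fixed `z`, the translate of the Schwartz density by `z` is a bounded differentiable
multiplier. Integration by parts in `x` under the `z` integral gives the result. -/
lemma schwartz_integral_conv_dens {R : ℝ} (hR : 0 ≤ R) (k j : Fin 2) (φ : 𝓢(Plane, ℂ)) {p q : L2}
    (hp : MemH1 p) (hq : MemH1 q) :
    ∫ x, conv R k (dens (toL2 φ) (toL2 φ)) x * derivDens j p q x =
      -∫ x, conv R k (derivDens j (toL2 φ) (toL2 φ)) x * dens p q x := by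
  set r : Plane → ℂ := fun x => (starRingEnd ℂ) (φ x) * φ x with hr
  set r' : Plane → ℂ := fun x =>
    (starRingEnd ℂ) ((∂_{e j} φ) x) * φ x + (starRingEnd ℂ) (φ x) * (∂_{e j} φ) x with hr'
  have hrae : dens (toL2 φ) (toL2 φ) =ᵐ[volume] r := by
    filter_upwards [φ.coeFn_toLp 2 volume] with x hx
    rw [dens, hx]
  have hr'ae : derivDens j (toL2 φ) (toL2 φ) =ᵐ[volume] r' := by
    filter_upwards [φ.coeFn_toLp 2 volume, (∂_{e j} φ).coeFn_toLp 2 volume] with x hx hx'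
    rw [derivDens, dens, dens, weakPartial_toL2, hx, hx']
  have hrd : ∀ x, HasFDerivAt r (schwartzConj φ x • fderiv ℝ φ x + φ x • fderiv ℝ (schwartzConj φ) x)
      x := fun x => ((schwartzConj φ).hasFDerivAt x).mul (φ.hasFDerivAt x)
  have hrd' : ∀ x, fderiv ℝ r x (e j) = r' x := fun x => by
    rw [(hrd x).fderiv, hr']
    simp only [← lineDerivOp_schwartzConj]
    rw [SchwartzMap.lineDerivOp_apply_eq_fderiv,
      SchwartzMap.lineDerivOp_apply_eq_fderiv, ← schwartzConj_apply]
    simp only [add_apply, smul_apply, smul_eq_mul]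
    ring
  have hrc : Continuous r := by
    have := φ.continuous
    have := Complex.continuous_conj
    fun_prop
  have hr'c : Continuous r' := by
    have := φ.continuous
    have := (∂_{e j} φ).continuous
    have := Complex.continuous_conj
    fun_prop
  obtain ⟨C, hC⟩ := multiplier_schwartz φ
  obtain ⟨C', hC'⟩ := multiplier_schwartz (∂_{e j} φ)
  have hC0 := hC.nonneg
  have hC0' := hC'.nonneg
  have hrb : ∀ x, ‖r x‖ ≤ C * C := fun x => by
    rw [hr, norm_mul, RCLike.norm_conj]
    gcongr <;> exact hC.bound x
  have hr'b : ∀ x, ‖r' x‖ ≤ C' * C + C * C' := fun x => by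
    refine (norm_add_le _ _).trans ?_
    rw [norm_mul, norm_mul, RCLike.norm_conj, RCLike.norm_conj]
    gcongr <;> first | exact hC.bound x | exact hC'.bound x
  have hu := memH2_toLp φ
  have hrr : riesz r ≠ ∞ := by
    have h := (hu.memH1.hardy_ne_top)
    refine riesz_ne_top (Lp.aestronglyMeasurable (toL2 φ)) (Lp.aestronglyMeasurable (toL2 φ))
      ?_ h h
    filter_upwards [hrae, norm_dens_le (toL2 φ) (toL2 φ)] with x h1 h2
    rwa [← h1]
  have hrr' : riesz r' ≠ ∞ := by
    have h1 : riesz r' = riesz (derivDens j (toL2 φ) (toL2 φ)) := by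
      unfold riesz
      congr 1 with x
      refine lintegral_congr_ae ?_
      filter_upwards [hr'ae] with y hy
      rw [hy]
    rw [h1]
    exact riesz_derivDens_ne_top j hu hu
  rw [conv_congr hrae, conv_congr hr'ae,
    integral_conv_mul_eq_shift hR k hrc hrr (integrable_derivDens j p q),
    integral_conv_mul_eq_shift hR k hr'c hrr' (integrable_dens p q), ← integral_neg]
  congr 1 with z
  rw [← mul_neg]
  congr 1
  have hs : Multiplier (fun x => r (x - z)) (C * C) :=
    ⟨(hrc.comp (by fun_prop)).aestronglyMeasurable, fun x => hrb _⟩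
  have hs' : Multiplier (fun x => r' (x - z)) (C' * C + C * C') :=
    ⟨(hr'c.comp (by fun_prop)).aestronglyMeasurable, fun x => hr'b _⟩
  rw [integral_mul_derivDens hs]
  refine MemH1.integral_mul_weakPartial hs hs' ?_ ?_ hp hq
  · intro x
    exact DifferentiableAt.comp (g := r) (f := fun y : Plane => y - z) x
      (hrd (x - z)).differentiableAt (by fun_prop)
  · intro x
    rw [fderiv_comp_sub, hrd']

/-- The derivative of the convolution `∇^⊥ w_R ∗ |u|²`, tested against `p̄ q`. -/
lemma integral_conv_dens_mul_derivDens {R : ℝ} (hR : 0 ≤ R) (k j : Fin 2) {u p q : L2}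
    (hu : MemH1 u) (hp : MemH2 p) (hq : MemH2 q) :
    ∫ x, conv R k (dens u u) x * derivDens j p q x =
      -∫ x, conv R k (derivDens j u u) x * dens p q x := by
  have h1 := multiplier_conv hR k (integrable_derivDens j p q).1 (riesz_derivDens_ne_top j hp hq)
  have hpq := riesz_dens_ne_top hp.memH1.hardy_ne_top hq.memH1.hardy_ne_top
  have h2 := multiplier_conv hR k (integrable_dens p q).1 hpq
  -- Antisymmetry puts both convolutions on the fixed densities of `p, q`, which yield bounded
  -- multipliers. Both sides are then continuous in `u` and its gradient, and the Schwartz case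
  -- extends by density.
  have swap1 : ∀ u : L2, ∫ x, conv R k (dens u u) x * derivDens j p q x =
      -∫ x, conv R k (derivDens j p q) x * ((starRingEnd ℂ) (u x) * u x) := fun u => by
    rw [eq_comm, neg_eq_iff_eq_neg]
    refine (integral_conv_mul hR k (integrable_derivDens j p q).1
      (riesz_derivDens_ne_top j hp hq) (integrable_dens u u)).trans ?_
    simp only [mul_comm]
  have swap2 : ∀ u : L2, ∫ x, conv R k (derivDens j u u) x * dens p q x =
      -((∫ x, conv R k (dens p q) x * ((starRingEnd ℂ) (weakPartial j u x) * u x)) +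
        ∫ x, conv R k (dens p q) x * ((starRingEnd ℂ) (u x) * weakPartial j u x)) := fun u => by
    rw [eq_comm, neg_eq_iff_eq_neg, ← integral_mul_derivDens h2]
    refine (integral_conv_mul hR k (integrable_dens p q).1 hpq
      (integrable_derivDens j u u)).trans ?_
    simp only [mul_comm]
  rw [swap1, swap2, neg_neg, neg_eq_iff_eq_neg]
  obtain ⟨φ, hφ, hφ'⟩ := hu.exists_schwartz
  refine tendsto_nhds_unique (h1.tendsto_integral hφ hφ) ?_
  refine (((h2.tendsto_integral (hφ' j) hφ).add (h2.tendsto_integral hφ (hφ' j))).neg).congr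
    fun n => ?_
  have := schwartz_integral_conv_dens hR k j (φ n) hp.memH1 hq.memH1
  rw [swap1, swap2, neg_neg, neg_eq_iff_eq_neg, weakPartial_toL2] at this
  exact this.symm

lemma vecPot_eq_conv (R : ℝ) (u : L2) (j : Fin 2) :
    (fun x => (vecPot R u j x : ℂ)) = conv R j (dens u u) := by
  funext x
  rw [vecPot, ← conv_ofReal]
  congr 1 with y
  rw [dens, conj_mul_self_eq]

/-- The vector potential times `u` has a weak derivative. -/
lemma hasWeakPartial_mulL2_conv {R : ℝ} (hR : 0 ≤ R) (k j : Fin 2) {u : L2} (hu : MemH2 u) :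
    HasWeakPartial j (mulL2 (conv R k (dens u u)) u)
      (mulL2 (conv R k (dens u u)) (weakPartial j u) + mulL2 (conv R k (derivDens j u u)) u) := by
  have ha := multiplier_conv hR k (integrable_dens u u).1
    (riesz_dens_ne_top hu.memH1.hardy_ne_top hu.memH1.hardy_ne_top)
  have hd := multiplier_conv hR k (integrable_derivDens j u u).1 (riesz_derivDens_ne_top j hu hu)
  rw [hasWeakPartial_iff]
  intro ψ
  -- Taking `p = ψ̄` turns the sesquilinear density `p̄ u` into the product `ψ u` of the
  -- distributional pairing.
  have h := integral_conv_dens_mul_derivDens hR k j hu.memH1 (memH2_toLp (schwartzConj ψ)) hu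
  have hcc : ∀ φ : 𝓢(Plane, ℂ), ∀ᵐ x ∂(volume : Measure Plane), toL2 φ x = φ x :=
    fun φ => φ.coeFn_toLp 2 volume
  have e1 : ∀ {a : Plane → ℂ} {C : ℝ}, Multiplier a C → ∀ f : L2,
      ∫ x, a x * ((starRingEnd ℂ) (toL2 (schwartzConj ψ) x) * f x) = ∫ x, ψ x * mulL2 a f x :=
    fun {a C} ha f => by
      refine integral_congr_ae ?_
      filter_upwards [hcc (schwartzConj ψ), ha.coeFn_mulL2 f] with x h1 h2
      rw [h1, h2, schwartzConj_apply, Complex.conj_conj]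
      ring
  have e2 : ∫ x, conv R k (dens u u) x *
      ((starRingEnd ℂ) (weakPartial j (toL2 (schwartzConj ψ)) x) * u x) =
      ∫ x, (∂_{e j} ψ) x * mulL2 (conv R k (dens u u)) u x := by
    refine integral_congr_ae ?_
    rw [weakPartial_toL2]
    filter_upwards [hcc (∂_{e j} (schwartzConj ψ)), ha.coeFn_mulL2 u] with x h1 h2
    rw [h1, h2, lineDerivOp_schwartzConj, Complex.conj_conj]
    ring
  rw [integral_mul_derivDens ha, e2, e1 ha] at h
  have h' : ∫ x, conv R k (derivDens j u u) x * dens (toL2 (schwartzConj ψ)) u x =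
      ∫ x, ψ x * mulL2 (conv R k (derivDens j u u)) u x := e1 hd u
  rw [h'] at h
  have hi : ∀ f : L2, Integrable fun x => ψ x * f x := fun f => by
    refine (integrable_conj_mul (toL2 (schwartzConj ψ)) f).congr ?_
    filter_upwards [hcc (schwartzConj ψ)] with x h1
    rw [h1, schwartzConj_apply, Complex.conj_conj]
  have e3 : ∫ x, ψ x * (mulL2 (conv R k (dens u u)) (weakPartial j u) +
      mulL2 (conv R k (derivDens j u u)) u : L2) x =
      (∫ x, ψ x * mulL2 (conv R k (dens u u)) (weakPartial j u) x) +
      ∫ x, ψ x * mulL2 (conv R k (derivDens j u u)) u x := by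
    rw [← integral_add (hi _) (hi _)]
    refine integral_congr_ae ?_
    filter_upwards [Lp.coeFn_add (mulL2 (conv R k (dens u u)) (weakPartial j u))
      (mulL2 (conv R k (derivDens j u u)) u)] with x hx
    rw [hx, Pi.add_apply, mul_add]
  rw [e3]
  linear_combination h

end CSS

namespace CSS

open scoped ENNReal InnerProductSpace

/-! ### The magnetic momentum -/

lemma conj_dens (f g : L2) (x : Plane) : (starRingEnd ℂ) (dens f g x) = dens g f x := by
  simp [dens, mul_comm]

lemma conj_conv_dens_self (R : ℝ) (j : Fin 2) (u : L2) (x : Plane) :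
    (starRingEnd ℂ) (conv R j (dens u u) x) = conv R j (dens u u) x := by
  rw [← conv_conj]
  simp only [conj_dens]

lemma magMomentum_eq (β R : ℝ) (u : L2) (j : Fin 2) (f : L2) :
    magMomentum β R u j f =
      -(Complex.I • weakPartial j f) + (β : ℂ) • mulL2 (conv R j (dens u u)) f := by
  rw [magMomentum, vecPot_eq_conv]

lemma multiplier_conv_dens {R : ℝ} (hR : 0 ≤ R) (j : Fin 2) {u : L2} (hu : hardy u ≠ ∞) :
    Multiplier (conv R j (dens u u)) (36 * (hardy u).toReal) := by
  refine ⟨aestronglyMeasurable_conv R j (integrable_dens u u).1, fun x => ?_⟩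
  have := norm_conv_le_sqrt hR j (Lp.aestronglyMeasurable u) (Lp.aestronglyMeasurable u)
    (norm_dens_le u u) hu hu x
  rwa [Real.mul_self_sqrt ENNReal.toReal_nonneg] at this

section

variable {β R : ℝ} {u : L2} {j : Fin 2}

lemma magMomentum_sub (hR : 0 ≤ R) (hu : hardy u ≠ ∞) {f g : L2} (hf : MemH1 f)
    (hg : MemH1 g) :
    magMomentum β R u j (f - g) = magMomentum β R u j f - magMomentum β R u j g := by
  rw [magMomentum_eq, magMomentum_eq, magMomentum_eq, weakPartial_sub hf hg,
    (multiplier_conv_dens hR j hu).mulL2_sub]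
  module

/-- `Pⱼ` is symmetric because the vector potential is real. Only the one derivative `∂ⱼF` is needed,
so `F` need not be known to lie in `H¹`. -/
lemma inner_magMomentum_left (hR : 0 ≤ R) (hu : hardy u ≠ ∞) {F F' g : L2}
    (hF : HasWeakPartial j F F') (hg : MemH1 g) :
    ⟪magMomentum β R u j F, g⟫_ℂ = ⟪F, magMomentum β R u j g⟫_ℂ := by
  have ha := multiplier_conv_dens hR j hu
  rw [magMomentum_eq, magMomentum_eq, hF.weakPartial_eq, inner_add_left, inner_add_right,
    inner_neg_left, inner_neg_right, inner_smul_left, inner_smul_left, inner_smul_right,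
    inner_smul_right, hF.inner_eq hg, ha.inner_mulL2_comm (conj_conv_dens_self R j u)]
  simp

/-- This ensures that the outer `Pⱼ` in `cssRHS` acts through a true weak derivative and not through
the default value `0`. -/
lemma hasWeakPartial_magMomentum (hR : 0 ≤ R) (hu : MemH2 u) :
    ∃ F' : L2, HasWeakPartial j (magMomentum β R u j u) F' := by
  have h1 := ((hu.memH1_weakPartial j).hasWeakPartial j).smul (-Complex.I)
  have h2 := (hasWeakPartial_mulL2_conv hR j j hu).smul (β : ℂ)
  have h3 := h1.add h2
  rw [neg_smul, ← magMomentum_eq] at h3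
  exact ⟨_, h3⟩

lemma inner_magMomentum_magMomentum (hR : 0 ≤ R) (hu : MemH2 u) {g : L2} (hg : MemH1 g) :
    ⟪magMomentum β R u j (magMomentum β R u j u), g⟫_ℂ =
      ⟪magMomentum β R u j u, magMomentum β R u j g⟫_ℂ := by
  obtain ⟨F', hF⟩ := hasWeakPartial_magMomentum (β := β) (j := j) hR hu
  exact inner_magMomentum_left hR hu.memH1.hardy_ne_top hF hg

lemma coeFn_magMomentum (hR : 0 ≤ R) (hu : hardy u ≠ ∞) (f : L2) :
    ∀ᵐ x ∂(volume : Measure Plane), magMomentum β R u j f x =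
      -(Complex.I * weakPartial j f x) + β * (conv R j (dens u u) x * f x) := by
  rw [magMomentum_eq]
  filter_upwards [Lp.coeFn_add (-(Complex.I • weakPartial j f))
      ((β : ℂ) • mulL2 (conv R j (dens u u)) f), Lp.coeFn_neg (Complex.I • weakPartial j f),
    Lp.coeFn_smul Complex.I (weakPartial j f),
    Lp.coeFn_smul (β : ℂ) (mulL2 (conv R j (dens u u)) f),
    (multiplier_conv_dens hR j hu).coeFn_mulL2 f] with x h1 h2 h3 h4 h5
  rw [h1, Pi.add_apply, h2, Pi.neg_apply, h3, h4, Pi.smul_apply, Pi.smul_apply, h5]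
  simp

lemma norm_magMomentum_le (hR : 0 ≤ R) (hu : hardy u ≠ ∞) (f : L2) :
    ‖magMomentum β R u j f‖ ≤ ‖weakPartial j f‖ + |β| * (36 * (hardy u).toReal * ‖f‖) := by
  rw [magMomentum_eq]
  refine (norm_add_le _ _).trans ?_
  rw [norm_neg, norm_smul, norm_smul, Complex.norm_I, one_mul, Complex.norm_real,
    Real.norm_eq_abs]
  gcongr
  exact (multiplier_conv_dens hR j hu).norm_mulL2_le f

lemma norm_weakPartial_le (hR : 0 ≤ R) (hu : hardy u ≠ ∞) (f : L2) :
    ‖weakPartial j f‖ ≤ ‖magMomentum β R u j f‖ + |β| * (36 * (hardy u).toReal * ‖f‖) := by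
  have h : Complex.I • weakPartial j f =
      (β : ℂ) • mulL2 (conv R j (dens u u)) f - magMomentum β R u j f := by
    rw [magMomentum_eq]; abel
  calc ‖weakPartial j f‖ = ‖Complex.I • weakPartial j f‖ := by
        rw [norm_smul, Complex.norm_I, one_mul]
    _ ≤ ‖(β : ℂ) • mulL2 (conv R j (dens u u)) f‖ + ‖magMomentum β R u j f‖ := by
        rw [h]; exact norm_sub_le _ _
    _ ≤ |β| * (36 * (hardy u).toReal * ‖f‖) + ‖magMomentum β R u j f‖ := by
        rw [norm_smul, Complex.norm_real, Real.norm_eq_abs]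
        gcongr
        exact (multiplier_conv_dens hR j hu).norm_mulL2_le f
    _ = _ := add_comm _ _

/-- The two pieces are treated separately: `∂ⱼu` lies in `H¹`, and `Aⱼu` is a bounded multiple of
`u`. Full `H¹` regularity of `Pⱼu` is not needed. -/
lemma hardy_magMomentum_ne_top (hR : 0 ≤ R) (hu : MemH2 u) :
    hardy (magMomentum β R u j u) ≠ ∞ := by
  have hu' := hu.memH1.hardy_ne_top
  have ha := multiplier_conv_dens hR j hu'
  have hm1 : AEStronglyMeasurable (fun x => -Complex.I * weakPartial j u x) volume :=
    (Lp.aestronglyMeasurable _).const_mul _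
  have h1 : hardy (fun x => -Complex.I * weakPartial j u x) ≠ ∞ :=
    hardy_mul_ne_top (C := 1) (fun x => by simp) (hu.memH1_weakPartial j).hardy_ne_top
  have h2 : hardy (fun x => (β * conv R j (dens u u) x) * u x) ≠ ∞ := by
    refine hardy_mul_ne_top (C := |β| * (36 * (hardy u).toReal)) (fun x => ?_) hu'
    rw [norm_mul, Complex.norm_real, Real.norm_eq_abs]
    gcongr
    exact ha.bound x
  have h3 : hardy (magMomentum β R u j u) =
      hardy (fun x => -Complex.I * weakPartial j u x + (β * conv R j (dens u u) x) * u x) := by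
    refine hardy_congr ?_
    filter_upwards [coeFn_magMomentum (β := β) (j := j) hR hu' u] with x hx
    rw [hx]; ring
  rw [h3]
  refine ((hardy_add_le hm1).trans_lt ?_).ne
  exact ENNReal.add_lt_top.2 ⟨ENNReal.mul_lt_top (by simp) h1.lt_top,
    ENNReal.mul_lt_top (by simp) h2.lt_top⟩

end

/-- The charge current density `2 Re (ū Pⱼu)`. -/
noncomputable def currentDens (β R : ℝ) (u : L2) (j : Fin 2) (x : Plane) : ℂ :=
  dens (magMomentum β R u j u) u x + dens u (magMomentum β R u j u) x

/-! ### The current and the nonlocal scalar potential -/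

section

variable {β R : ℝ} {u : L2} {j : Fin 2}

lemma integrable_currentDens : Integrable (currentDens β R u j) :=
  (integrable_dens _ _).add (integrable_dens _ _)

lemma conj_currentDens (x : Plane) :
    (starRingEnd ℂ) (currentDens β R u j x) = currentDens β R u j x := by
  rw [currentDens, map_add, conj_dens, conj_dens, add_comm]

lemma riesz_currentDens_ne_top (hR : 0 ≤ R) (hu : MemH2 u) :
    riesz (currentDens β R u j) ≠ ∞ := by
  have h := hardy_magMomentum_ne_top (β := β) (j := j) hR hu
  have h' := hu.memH1.hardy_ne_top
  exact riesz_add_ne_top (integrable_dens _ _).1 (riesz_dens_ne_top h h') (riesz_dens_ne_top h' h)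

/-- Expanding `2 Re(ū Pⱼu)`, the gradient part gives `J[u]` and the potential part gives `2βAⱼ|u|²`.
The bracket in the equation is thus a gauge-covariant current. -/
lemma currentDens_ae_eq (hR : 0 ≤ R) (hu : hardy u ≠ ∞) :
    ∀ᵐ y ∂(volume : Measure Plane), currentDens β R u j y =
      2 * (β : ℂ) * (vecPot R u j y : ℂ) * ((‖u y‖ ^ 2 : ℝ) : ℂ) + current u j y := by
  filter_upwards [coeFn_magMomentum (β := β) (j := j) hR hu u] with y hy
  have h1 := congrFun (vecPot_eq_conv R u j) y
  rw [h1, currentDens, dens, dens, hy, ← conj_mul_self_eq, current, map_add, map_neg, map_mul,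
    map_mul, map_mul, conj_conv_dens_self, Complex.conj_I, Complex.conj_ofReal]
  ring

lemma scalarConv_eq (hR : 0 ≤ R) (hu : MemH2 u) (x : Plane) :
    scalarConv β R u x = ∑ j, conv R j (currentDens β R u j) x := by
  unfold conv scalarConv
  rw [← integral_finsetSum]
  · refine integral_congr_ae ?_
    have h := fun j => currentDens_ae_eq (β := β) (j := j) hR hu.memH1.hardy_ne_top
    filter_upwards [ae_all_iff.2 h] with y hy
    refine Finset.sum_congr rfl fun j _ => ?_
    rw [hy j]
  · exact fun j _ => integrable_conv hR j integrable_currentDens.1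
      (riesz_currentDens_ne_top hR hu) x

lemma multiplier_conv_currentDens (hR : 0 ≤ R) (hu : MemH2 u) (j : Fin 2) :
    Multiplier (conv R j (currentDens β R u j)) (36 * (riesz (currentDens β R u j)).toReal) :=
  multiplier_conv hR j integrable_currentDens.1 (riesz_currentDens_ne_top hR hu)

lemma multiplier_scalarConv (hR : 0 ≤ R) (hu : MemH2 u) :
    ∃ C, Multiplier (scalarConv β R u) C := by
  have h := multiplier_conv_currentDens (β := β) hR hu
  rw [show scalarConv β R u = fun x => ∑ j, conv R j (currentDens β R u j) x from
    funext fun x => scalarConv_eq hR hu x]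
  refine ⟨∑ j, 36 * (riesz (currentDens β R u j)).toReal,
    Finset.aestronglyMeasurable_fun_sum _ fun j _ => (h j).meas, fun x => ?_⟩
  exact (norm_sum_le _ _).trans (Finset.sum_le_sum fun j _ => (h j).bound x)

lemma conj_scalarConv (hR : 0 ≤ R) (hu : MemH2 u) (x : Plane) :
    (starRingEnd ℂ) (scalarConv β R u x) = scalarConv β R u x := by
  rw [scalarConv_eq hR hu, map_sum]
  refine Finset.sum_congr rfl fun j _ => ?_
  rw [← conv_conj]
  simp only [conj_currentDens]

/-- Symmetry of `Pⱼ` gives `⟪Pⱼ(Pⱼu), u⟫ = ‖Pⱼu‖²`, and the scalar potential is real. This is the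
source of mass conservation. -/
lemma im_inner_cssRHS (hR : 0 ≤ R) (hu : MemH2 u) : (⟪cssRHS β R u, u⟫_ℂ).im = 0 := by
  obtain ⟨C, hS⟩ := multiplier_scalarConv (β := β) hR hu
  have h1 : (⟪mulL2 (scalarConv β R u) u, u⟫_ℂ).im = 0 := by
    rw [← Complex.conj_eq_iff_im, inner_conj_symm, hS.inner_mulL2_comm (conj_scalarConv hR hu)]
  rw [cssRHS, inner_sub_left, sum_inner, Complex.sub_im, inner_smul_left, Complex.conj_ofReal,
    Complex.im_ofReal_mul, h1, mul_zero, sub_zero, Complex.im_sum]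
  refine Finset.sum_eq_zero fun j _ => ?_
  rw [inner_magMomentum_magMomentum hR hu hu.memH1]
  exact inner_self_im (𝕜 := ℂ) _

end

/-! ### First-order expansion of the energy -/

lemma norm_le_h2Norm (f : L2) : ‖f‖ ≤ h2Norm f := by
  refine Real.le_sqrt_of_sq_le ?_
  have h1 : 0 ≤ ∑ j, ‖weakPartial j f‖ ^ 2 := Finset.sum_nonneg fun _ _ => sq_nonneg _
  have h2 : 0 ≤ ∑ j, ∑ k, ‖weakPartial j (weakPartial k f)‖ ^ 2 :=
    Finset.sum_nonneg fun _ _ => Finset.sum_nonneg fun _ _ => sq_nonneg _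
  linarith

lemma norm_weakPartial_le_h2Norm (f : L2) (j : Fin 2) : ‖weakPartial j f‖ ≤ h2Norm f := by
  refine Real.le_sqrt_of_sq_le ?_
  have h := Finset.single_le_sum (f := fun j => ‖weakPartial j f‖ ^ 2) (fun _ _ => sq_nonneg _)
    (Finset.mem_univ j)
  have h2 : 0 ≤ ∑ j, ∑ k, ‖weakPartial j (weakPartial k f)‖ ^ 2 :=
    Finset.sum_nonneg fun _ _ => Finset.sum_nonneg fun _ _ => sq_nonneg _
  have h3 := sq_nonneg ‖f‖
  linarith

lemma norm_weakPartial_weakPartial_le_h2Norm (f : L2) (j k : Fin 2) :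
    ‖weakPartial j (weakPartial k f)‖ ≤ h2Norm f := by
  refine Real.le_sqrt_of_sq_le ?_
  have h := Finset.single_le_sum (f := fun k => ‖weakPartial j (weakPartial k f)‖ ^ 2)
    (fun _ _ => sq_nonneg _) (Finset.mem_univ k)
  have h' := Finset.single_le_sum (f := fun j => ∑ k, ‖weakPartial j (weakPartial k f)‖ ^ 2)
    (fun _ _ => Finset.sum_nonneg fun _ _ => sq_nonneg _) (Finset.mem_univ j)
  have h2 : 0 ≤ ∑ j, ‖weakPartial j f‖ ^ 2 := Finset.sum_nonneg fun _ _ => sq_nonneg _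
  have h3 := sq_nonneg ‖f‖
  linarith

section

variable {β R : ℝ} {u v : L2} {j : Fin 2}

/-- The change of the density `|·|²` from `u` to `u + f`. -/
noncomputable def densIncrement (u f : L2) (x : Plane) : ℂ :=
  (dens u f x + dens f u x) + dens f f x

lemma dens_self_ae_eq (u v : L2) :
    dens v v =ᵐ[volume] fun x => dens u u x + densIncrement u (v - u) x := by
  filter_upwards [Lp.coeFn_sub v u] with x hx
  simp only [densIncrement, dens, hx, Pi.sub_apply, map_sub]
  ring

lemma integrable_densIncrement (u f : L2) : Integrable (densIncrement u f) :=
  ((integrable_dens _ _).add (integrable_dens _ _)).add (integrable_dens _ _)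

lemma riesz_densIncrement_ne_top {f : L2} (hu : hardy u ≠ ∞) (hf : hardy f ≠ ∞) :
    riesz (densIncrement u f) ≠ ∞ :=
  riesz_add_ne_top ((integrable_dens _ _).add (integrable_dens _ _)).1
    (riesz_add_ne_top (integrable_dens _ _).1 (riesz_dens_ne_top hu hf) (riesz_dens_ne_top hf hu))
    (riesz_dens_ne_top hf hf)

lemma conj_densIncrement (u f : L2) (x : Plane) :
    (starRingEnd ℂ) (densIncrement u f x) = densIncrement u f x := by
  simp only [densIncrement, map_add, conj_dens]
  ring

lemma multiplier_conv_densIncrement (hR : 0 ≤ R) (j : Fin 2) {f : L2} (hu : hardy u ≠ ∞)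
    (hf : hardy f ≠ ∞) :
    Multiplier (conv R j (densIncrement u f))
      (36 * (2 * √(hardy u).toReal + √(hardy f).toReal) * √(hardy f).toReal) := by
  refine ⟨aestronglyMeasurable_conv R j (integrable_densIncrement u f).1, fun x => ?_⟩
  have hm := Lp.aestronglyMeasurable u
  have hm' := Lp.aestronglyMeasurable f
  have h1 := norm_conv_le_sqrt hR j hm hm' (norm_dens_le u f) hu hf x
  have h2 := norm_conv_le_sqrt hR j hm' hm (norm_dens_le f u) hf hu x
  have h3 := norm_conv_le_sqrt hR j hm' hm' (norm_dens_le f f) hf hf x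
  have r1 := riesz_dens_ne_top hu hf
  have r2 := riesz_dens_ne_top hf hu
  have r3 := riesz_dens_ne_top hf hf
  have i1 := (integrable_dens u f).1
  have i2 := (integrable_dens f u).1
  have h4 : conv R j (densIncrement u f) x =
      conv R j (dens u f) x + conv R j (dens f u) x + conv R j (dens f f) x := by
    rw [← conv_add hR j i1 r1 i2 r2]
    exact conv_add hR j (i1.add i2) (riesz_add_ne_top i1 r1 r2) (integrable_dens f f).1 r3 x
  rw [h4]
  refine (norm_add₃_le).trans ((add_le_add (add_le_add h1 h2) h3).trans (le_of_eq ?_))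
  ring

/-- The vector potential is linear in the density, so the change is exact, with no Taylor remainder.
-/
lemma magMomentum_change (hR : 0 ≤ R) (hu : MemH2 u) (hv : MemH2 v) :
    magMomentum β R v j v = magMomentum β R u j u + (magMomentum β R u j (v - u) +
      (β : ℂ) • mulL2 (conv R j (densIncrement u (v - u))) v) := by
  have hu' := hu.memH1.hardy_ne_top
  have hv' := hv.memH1.hardy_ne_top
  have hf' := (hv.memH1.sub hu.memH1).hardy_ne_top
  have hau := multiplier_conv_dens hR j hu'
  have hav := multiplier_conv_dens hR j hv'
  have hb := multiplier_conv_densIncrement hR j hu' hf'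
  have h1 : mulL2 (conv R j (dens v v)) v =
      mulL2 (conv R j (dens u u)) v + mulL2 (conv R j (densIncrement u (v - u))) v := by
    refine Lp.ext ?_
    filter_upwards [hau.coeFn_mulL2 v, hav.coeFn_mulL2 v, hb.coeFn_mulL2 v,
      Lp.coeFn_add (mulL2 (conv R j (dens u u)) v)
        (mulL2 (conv R j (densIncrement u (v - u))) v)] with x h1 h2 h3 h4
    rw [h4, Pi.add_apply, h1, h2, h3, conv_congr (dens_self_ae_eq u v),
      conv_add hR j (integrable_dens u u).1 (riesz_dens_ne_top hu' hu')
        (integrable_densIncrement u _).1 (riesz_densIncrement_ne_top hu' hf'), add_mul]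
  rw [magMomentum_sub hR hu' hv.memH1 hu.memH1, magMomentum_eq β R v, h1, magMomentum_eq β R u j v]
  module

/-- Antisymmetry moves the convolution from the density increment onto the current, and summing over
`j` produces the scalar potential. The increment `2 Re(ū f) + |f|²` then yields the linear term
present in `cssRHS` and a quadratic remainder. -/
lemma sum_inner_conv_densIncrement (hR : 0 ≤ R) (hu : MemH2 u) {f : L2} (hf : MemH2 f) :
    ∑ j, 2 * (⟪magMomentum β R u j u, mulL2 (conv R j (densIncrement u f)) u⟫_ℂ).re =
      -(2 * (⟪mulL2 (scalarConv β R u) u, f⟫_ℂ).re +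
        (⟪f, mulL2 (scalarConv β R u) f⟫_ℂ).re) := by
  have hu' := hu.memH1.hardy_ne_top
  have hf' := hf.memH1.hardy_ne_top
  have hτ := riesz_densIncrement_ne_top hu' hf'
  obtain ⟨C, hS⟩ := multiplier_scalarConv (β := β) hR hu
  have key : ∀ z : ℂ, ((2 * z.re : ℝ) : ℂ) = z + (starRingEnd ℂ) z := fun z => by
    rw [Complex.add_conj]
  have hj : ∀ j, ((2 * (⟪magMomentum β R u j u,
      mulL2 (conv R j (densIncrement u f)) u⟫_ℂ).re : ℝ) : ℂ) =
      -∫ x, densIncrement u f x * conv R j (currentDens β R u j) x := fun j => by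
    have hb := multiplier_conv_densIncrement hR j hu' hf'
    have hbc : ∀ x, (starRingEnd ℂ) (conv R j (densIncrement u f) x) =
        conv R j (densIncrement u f) x := fun x => by
      rw [← conv_conj]; simp only [conj_densIncrement]
    rw [key, inner_conj_symm, hb.inner_mulL2_comm hbc, hb.inner_mulL2, hb.inner_mulL2,
      ← integral_conv_mul hR j (integrable_densIncrement u f).1 hτ integrable_currentDens,
      ← integral_add ((integrable_conj_mul _ _).bdd_mul hb.meas (ae_of_all _ hb.bound))
        ((integrable_conj_mul _ _).bdd_mul hb.meas (ae_of_all _ hb.bound))]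
    simp only [currentDens, dens, mul_add]
  have hmulS : ∀ p q : L2, Integrable fun x => scalarConv β R u x * dens p q x := fun p q =>
    (integrable_dens p q).bdd_mul hS.meas (ae_of_all _ hS.bound)
  have hsum : ((∑ j, 2 * (⟪magMomentum β R u j u,
      mulL2 (conv R j (densIncrement u f)) u⟫_ℂ).re : ℝ) : ℂ) =
      -(⟪u, mulL2 (scalarConv β R u) f⟫_ℂ + ⟪f, mulL2 (scalarConv β R u) u⟫_ℂ +
        ⟪f, mulL2 (scalarConv β R u) f⟫_ℂ) := by
    rw [Complex.ofReal_sum]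
    simp only [hj]
    rw [Finset.sum_neg_distrib, ← integral_finsetSum, hS.inner_mulL2, hS.inner_mulL2,
      hS.inner_mulL2]
    · congr 1
      have e1 := integral_add (hmulS u f) (hmulS f u)
      have e2 := integral_add ((hmulS u f).add (hmulS f u)) (hmulS f f)
      simp only [Pi.add_apply] at e2
      rw [e1] at e2
      refine Eq.trans ?_ e2
      congr 1 with x
      rw [← Finset.mul_sum, ← scalarConv_eq hR hu, densIncrement]
      ring
    · intro j _
      have hc := multiplier_conv_currentDens (β := β) hR hu j
      exact (integrable_densIncrement u f).mul_bdd hc.meas (ae_of_all _ hc.bound)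
  have hre := congrArg Complex.re hsum
  rw [Complex.ofReal_re] at hre
  rw [hre, Complex.neg_re, Complex.add_re, Complex.add_re]
  have h1 : (⟪u, mulL2 (scalarConv β R u) f⟫_ℂ).re = (⟪mulL2 (scalarConv β R u) u, f⟫_ℂ).re := by
    rw [hS.inner_mulL2_comm (conj_scalarConv hR hu)]
  have h2 : (⟪f, mulL2 (scalarConv β R u) u⟫_ℂ).re = (⟪mulL2 (scalarConv β R u) u, f⟫_ℂ).re := by
    rw [← inner_conj_symm, Complex.conj_re]
  rw [h1, h2]
  ring

/-- All terms linear in `v - u` are absorbed by `cssRHS`; what remains is at least quadratic in the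
increment. -/
lemma afEnergy_sub_eq (hR : 0 ≤ R) (hu : MemH2 u) (hv : MemH2 v) :
    afEnergy β R v - afEnergy β R u - 2 * (⟪cssRHS β R u, v - u⟫_ℂ).re =
      -(β * (⟪v - u, mulL2 (scalarConv β R u) (v - u)⟫_ℂ).re) +
      ∑ j, (2 * β * (⟪magMomentum β R u j u,
          mulL2 (conv R j (densIncrement u (v - u))) (v - u)⟫_ℂ).re +
        ‖magMomentum β R u j (v - u) +
          (β : ℂ) • mulL2 (conv R j (densIncrement u (v - u))) v‖ ^ 2) := by
  have hu' := hu.memH1.hardy_ne_top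
  have hf := hv.sub hu
  have hf' := hf.memH1.hardy_ne_top
  have hj : ∀ j, ‖magMomentum β R v j v‖ ^ 2 - ‖magMomentum β R u j u‖ ^ 2 =
      2 * (⟪magMomentum β R u j (magMomentum β R u j u), v - u⟫_ℂ).re +
      β * (2 * (⟪magMomentum β R u j u, mulL2 (conv R j (densIncrement u (v - u))) u⟫_ℂ).re) +
      (2 * β * (⟪magMomentum β R u j u,
          mulL2 (conv R j (densIncrement u (v - u))) (v - u)⟫_ℂ).re +
        ‖magMomentum β R u j (v - u) +
          (β : ℂ) • mulL2 (conv R j (densIncrement u (v - u))) v‖ ^ 2) := fun j => by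
    have hb := multiplier_conv_densIncrement hR j hu' hf'
    have hsplit : mulL2 (conv R j (densIncrement u (v - u))) v =
        mulL2 (conv R j (densIncrement u (v - u))) u +
          mulL2 (conv R j (densIncrement u (v - u))) (v - u) := by
      rw [← hb.mulL2_add]; congr 1; abel
    rw [magMomentum_change hR hu hv, norm_add_sq (𝕜 := ℂ), inner_add_right, inner_smul_right,
      inner_magMomentum_magMomentum hR hu hf.memH1]
    have : ⟪magMomentum β R u j u, mulL2 (conv R j (densIncrement u (v - u))) v⟫_ℂ =
        ⟪magMomentum β R u j u, mulL2 (conv R j (densIncrement u (v - u))) u⟫_ℂ +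
        ⟪magMomentum β R u j u, mulL2 (conv R j (densIncrement u (v - u))) (v - u)⟫_ℂ := by
      rw [hsplit, inner_add_right]
    rw [this]
    simp only [RCLike.re_to_complex, Complex.add_re, Complex.re_ofReal_mul]
    ring
  have hS := sum_inner_conv_densIncrement (β := β) hR hu hf
  have hcss : (⟪cssRHS β R u, v - u⟫_ℂ).re =
      ∑ j, (⟪magMomentum β R u j (magMomentum β R u j u), v - u⟫_ℂ).re -
        β * (⟪mulL2 (scalarConv β R u) u, v - u⟫_ℂ).re := by
    rw [cssRHS, inner_sub_left, sum_inner, inner_smul_left, Complex.conj_ofReal, Complex.sub_re,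
      Complex.re_ofReal_mul, Complex.re_sum]
  have hE : afEnergy β R v - afEnergy β R u =
      ∑ j, (‖magMomentum β R v j v‖ ^ 2 - ‖magMomentum β R u j u‖ ^ 2) := by
    rw [afEnergy, afEnergy, Finset.sum_sub_distrib]
  rw [hE, hcss]
  simp only [hj]
  rw [Finset.sum_add_distrib, Finset.sum_add_distrib, ← Finset.mul_sum _ _ β, hS,
    ← Finset.mul_sum]
  ring

lemma abs_afEnergy_sub_le (hR : 0 ≤ R) (hu : MemH2 u) :
    ∃ M, ∀ v : L2, MemH2 v → h2Norm (v - u) ≤ 1 →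
      |afEnergy β R v - afEnergy β R u - 2 * (⟪cssRHS β R u, v - u⟫_ℂ).re| ≤
        M * (‖v - u‖ * h2Norm (v - u)) := by
  obtain ⟨C, hS⟩ := multiplier_scalarConv (β := β) hR hu
  have hC := hS.nonneg
  have hu' := hu.memH1.hardy_ne_top
  set N := (hardy u).toReal with hN
  have hN0 : 0 ≤ N := ENNReal.toReal_nonneg
  -- The last `2` bounds `√n`, since `n ≤ 4δκ ≤ 4`. Then `B ≤ D√n` gives `B² ≤ 4D²δκ`, which is the
  -- choice of `M1`.
  set D : ℝ := 36 * (2 * √N + 2) with hD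
  have hD0 : 0 ≤ D := by positivity
  set M1 : ℝ := 4 * D ^ 2
  refine ⟨|β| * C + ∑ j, (|β| * ‖magMomentum β R u j u‖ * (M1 + 1) +
    (2 * (2 + 2 * (|β| * (36 * N)) ^ 2) + 2 * (|β| ^ 2 * (‖u‖ + 1) ^ 2 * M1))),
    fun v hv hκ1 => ?_⟩
  have hf := hv.sub hu
  have hf' := hf.memH1.hardy_ne_top
  rw [afEnergy_sub_eq hR hu hv]
  have hvu : ‖v‖ ≤ ‖u‖ + ‖v - u‖ := by
    have := norm_add_le u (v - u)
    simpa using this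
  set f := v - u with hfdef
  set δ := ‖f‖ with hδ
  set κ := h2Norm f with hκ
  have hδ0 : 0 ≤ δ := norm_nonneg _
  have hδκ : δ ≤ κ := norm_le_h2Norm f
  have hκ0 : 0 ≤ κ := hδ0.trans hδκ
  have hδδ : δ ^ 2 ≤ δ * κ := by rw [sq]; gcongr
  have hδ1 : δ * κ ≤ 1 := mul_le_one₀ (hδκ.trans hκ1) hκ0 hκ1
  have hv1 : ‖v‖ ≤ ‖u‖ + 1 := hvu.trans (by gcongr; exact hδκ.trans hκ1)
  set n := (hardy f).toReal with hn
  have hn0 : 0 ≤ n := ENNReal.toReal_nonneg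
  have hn4 : n ≤ 4 * (δ * κ) := by
    have h2 : n ≤ 2 * ‖f‖ * ∑ j, ‖weakPartial j f‖ :=
      ENNReal.toReal_le_of_le_ofReal (mul_nonneg (mul_nonneg zero_le_two (norm_nonneg _))
        (Finset.sum_nonneg fun _ _ => norm_nonneg _)) hf.memH1.hardy_le
    refine h2.trans ?_
    rw [Fin.sum_univ_two]
    have h0 := norm_weakPartial_le_h2Norm f 0
    have h1 := norm_weakPartial_le_h2Norm f 1
    calc 2 * ‖f‖ * (‖weakPartial 0 f‖ + ‖weakPartial 1 f‖) ≤ 2 * δ * (κ + κ) := by gcongr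
      _ = 4 * (δ * κ) := by ring
  have hsn : √n ≤ 2 := by
    rw [Real.sqrt_le_left zero_le_two]; linarith
  set B := 36 * (2 * √N + √n) * √n with hB
  have hB0 : 0 ≤ B := by positivity
  have hBD : B ≤ D * √n := by
    rw [hB, hD]
    gcongr
  have hB2 : B ^ 2 ≤ M1 * (δ * κ) := by
    calc B ^ 2 ≤ (D * √n) ^ 2 := by gcongr
      _ = D ^ 2 * n := by rw [mul_pow, Real.sq_sqrt hn0]
      _ ≤ D ^ 2 * (4 * (δ * κ)) := by gcongr
      _ = M1 * (δ * κ) := by ring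
  have hb := fun j => multiplier_conv_densIncrement hR j hu' hf'
  have t1 : |(⟪f, mulL2 (scalarConv β R u) f⟫_ℂ).re| ≤ C * (δ * κ) := by
    refine (Complex.abs_re_le_norm _).trans ((norm_inner_le_norm _ _).trans ?_)
    calc ‖f‖ * ‖mulL2 (scalarConv β R u) f‖ ≤ δ * (C * δ) := by
          gcongr; exact hS.norm_mulL2_le f
      _ = C * δ ^ 2 := by ring
      _ ≤ C * (δ * κ) := by gcongr
  have t2 : ∀ j, |2 * β * (⟪magMomentum β R u j u, mulL2 (conv R j (densIncrement u f)) f⟫_ℂ).re| ≤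
      |β| * ‖magMomentum β R u j u‖ * (M1 + 1) * (δ * κ) := fun j => by
    rw [abs_mul, abs_mul, abs_two]
    calc 2 * |β| * |(⟪magMomentum β R u j u, mulL2 (conv R j (densIncrement u f)) f⟫_ℂ).re|
        ≤ 2 * |β| * (‖magMomentum β R u j u‖ * (B * δ)) := by
          gcongr
          refine (Complex.abs_re_le_norm _).trans ((norm_inner_le_norm _ _).trans ?_)
          gcongr
          exact (hb j).norm_mulL2_le f
      _ = |β| * ‖magMomentum β R u j u‖ * (2 * B * δ) := by ring
      _ ≤ |β| * ‖magMomentum β R u j u‖ * (M1 * (δ * κ) + δ * κ) := by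
          gcongr
          linarith [two_mul_le_add_sq B δ]
      _ = _ := by ring
  have t3 : ∀ j, ‖magMomentum β R u j f + (β : ℂ) • mulL2 (conv R j (densIncrement u f)) v‖ ^ 2 ≤
      (2 * (2 + 2 * (|β| * (36 * N)) ^ 2) + 2 * (|β| ^ 2 * (‖u‖ + 1) ^ 2 * M1)) * (δ * κ) :=
    fun j => by
    have hsq : ∀ a b : ℝ, (a + b) ^ 2 ≤ 2 * a ^ 2 + 2 * b ^ 2 := fun a b => by
      linarith [two_mul_le_add_sq a b]
    have h1 : ‖magMomentum β R u j f‖ ^ 2 ≤ (2 + 2 * (|β| * (36 * N)) ^ 2) * (δ * κ) := by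
      have hw : ‖weakPartial j f‖ ^ 2 ≤ δ * κ := by
        refine (norm_weakPartial_sq_le hf j).trans ?_
        rw [mul_comm]
        gcongr
        exact norm_weakPartial_weakPartial_le_h2Norm f j j
      calc ‖magMomentum β R u j f‖ ^ 2 ≤ (‖weakPartial j f‖ + |β| * (36 * N * δ)) ^ 2 := by
            gcongr; exact norm_magMomentum_le hR hu' f
        _ ≤ 2 * ‖weakPartial j f‖ ^ 2 + 2 * (|β| * (36 * N * δ)) ^ 2 := hsq _ _
        _ = 2 * ‖weakPartial j f‖ ^ 2 + 2 * (|β| * (36 * N)) ^ 2 * δ ^ 2 := by ring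
        _ ≤ 2 * (δ * κ) + 2 * (|β| * (36 * N)) ^ 2 * (δ * κ) := by gcongr
        _ = _ := by ring
    have h2 : ‖(β : ℂ) • mulL2 (conv R j (densIncrement u f)) v‖ ^ 2 ≤
        |β| ^ 2 * (‖u‖ + 1) ^ 2 * M1 * (δ * κ) := by
      rw [norm_smul, Complex.norm_real, Real.norm_eq_abs, mul_pow]
      calc |β| ^ 2 * ‖mulL2 (conv R j (densIncrement u f)) v‖ ^ 2
          ≤ |β| ^ 2 * (B * (‖u‖ + 1)) ^ 2 := by
            gcongr
            exact ((hb j).norm_mulL2_le v).trans (by gcongr)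
        _ = |β| ^ 2 * (‖u‖ + 1) ^ 2 * B ^ 2 := by ring
        _ ≤ |β| ^ 2 * (‖u‖ + 1) ^ 2 * (M1 * (δ * κ)) := by gcongr
        _ = _ := by ring
    calc _ ≤ (‖magMomentum β R u j f‖ +
          ‖(β : ℂ) • mulL2 (conv R j (densIncrement u f)) v‖) ^ 2 := by
          gcongr; exact norm_add_le _ _
      _ ≤ _ := hsq _ _
      _ ≤ 2 * ((2 + 2 * (|β| * (36 * N)) ^ 2) * (δ * κ)) +
          2 * (|β| ^ 2 * (‖u‖ + 1) ^ 2 * M1 * (δ * κ)) := by gcongr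
      _ = _ := by ring
  rw [add_mul, Finset.sum_mul]
  refine (abs_add_le _ _).trans (add_le_add ?_ ?_)
  · rw [abs_neg, abs_mul, mul_assoc]
    gcongr
  · refine (Finset.abs_sum_le_sum_abs _ _).trans (Finset.sum_le_sum fun j _ => ?_)
    refine (abs_add_le _ _).trans ?_
    rw [add_mul, abs_of_nonneg (sq_nonneg ‖_‖)]
    exact add_le_add (t2 j) (t3 j)

end

end CSS

namespace CSS

open scoped ENNReal InnerProductSpace

/-! ### Conservation laws -/

lemma eq_of_hasDerivWithinAt_zero {F : Type*} [NormedAddCommGroup F] [NormedSpace ℝ F]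
    {f : ℝ → F} {T : Set ℝ} (hT : T.OrdConnected) (h : ∀ t ∈ T, HasDerivWithinAt f 0 T t)
    {s t : ℝ} (hs : s ∈ T) (ht : t ∈ T) : f t = f s := by
  have := hT.convex.norm_image_sub_le_of_norm_hasDerivWithin_le (C := 0) (f' := fun _ => 0) h
    (fun _ _ => by simp) hs ht
  rw [zero_mul, norm_le_zero_iff, sub_eq_zero] at this
  exact this

namespace IsSolution

variable {β R : ℝ} {u₀ : L2} {T : Set ℝ} {u : ℝ → L2}

lemma norm_eq (h : IsSolution β R u₀ T u) (hR : 0 ≤ R) (hT : T.OrdConnected) (h0 : (0 : ℝ) ∈ T)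
    {t : ℝ} (ht : t ∈ T) : ‖u t‖ = ‖u₀‖ := by
  have hd : ∀ t ∈ T, HasDerivWithinAt (fun s => ⟪u s, u s⟫_ℂ) 0 T t := fun t ht => by
    obtain ⟨du, hdu, heq⟩ := h.equation t ht
    have h1 := hdu.inner ℂ hdu
    have him := im_inner_cssRHS (β := β) hR (h.memH2 t ht)
    rw [← heq, inner_smul_left, Complex.conj_I, neg_mul, Complex.neg_im, Complex.I_mul_im,
      neg_eq_zero] at him
    have h2 : ⟪u t, du⟫_ℂ + ⟪du, u t⟫_ℂ = 0 := by
      rw [← inner_conj_symm (u t) du, add_comm, Complex.add_conj, him]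
      simp
    rwa [h2] at h1
  have h1 := eq_of_hasDerivWithinAt_zero hT hd h0 ht
  rw [h.initial] at h1
  simp only [inner_self_eq_norm_sq_to_K] at h1
  have h2 : ‖u t‖ ^ 2 = ‖u₀‖ ^ 2 := by exact_mod_cast h1
  exact (pow_left_inj₀ (norm_nonneg _) (norm_nonneg _) two_ne_zero).1 h2

/-- The remainder is `O(|s - t|)` from `L²` differentiability times `o(1)` from `H²` continuity, so
only the linear term can contribute. -/
lemma hasDerivWithinAt_afEnergy (h : IsSolution β R u₀ T u) (hR : 0 ≤ R) {t : ℝ} (ht : t ∈ T) :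
    HasDerivWithinAt (fun s => afEnergy β R (u s)) 0 T t := by
  obtain ⟨du, hdu, heq⟩ := h.equation t ht
  obtain ⟨M, hM⟩ := abs_afEnergy_sub_le (β := β) hR (h.memH2 t ht)
  have hlin : HasDerivWithinAt (fun s => 2 * (⟪cssRHS β R (u t), u s - u t⟫_ℂ).re) 0 T t := by
    have h1 := ((hasDerivWithinAt_const t T (cssRHS β R (u t))).inner ℂ (hdu.sub_const (u t)))
    have h2 := (Complex.reCLM.hasFDerivAt.comp_hasDerivWithinAt t h1).const_mul 2
    -- By the equation the pairing is `⟪i du, du⟫`, which is purely imaginary.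
    have h3 : (⟪cssRHS β R (u t), du⟫_ℂ).re = 0 := by
      rw [← heq, inner_smul_left, inner_self_eq_norm_sq_to_K]
      simp [← Complex.ofReal_pow]
    simp only [inner_zero_left, add_zero, Complex.reCLM_apply, h3, mul_zero] at h2
    exact h2
  have hκ := h.continuous_h2 t ht
  have herr : (fun s => afEnergy β R (u s) - afEnergy β R (u t) -
      2 * (⟪cssRHS β R (u t), u s - u t⟫_ℂ).re) =o[𝓝[T] t] fun s => s - t := by
    have hO : (fun s => u s - u t) =O[𝓝[T] t] fun s => s - t :=
      (HasDerivAtFilter.isBigO_sub hdu).comp_tendsto (tendsto_id.prodMk (tendsto_const_pure (b := t)))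
    have ho : (fun s => ‖u s - u t‖ * h2Norm (u s - u t)) =o[𝓝[T] t] fun s => (s - t) * 1 :=
      hO.norm_left.mul_isLittleO ((Asymptotics.isLittleO_one_iff ℝ).2 hκ)
    simp only [mul_one] at ho
    refine Asymptotics.IsBigO.trans_isLittleO ?_ ho
    refine Asymptotics.IsBigO.of_bound M ?_
    filter_upwards [self_mem_nhdsWithin, hκ.eventually (Iic_mem_nhds zero_lt_one)] with s hs hs1
    have hb := hM (u s) (h.memH2 s hs) hs1
    rw [Real.norm_eq_abs, Real.norm_of_nonneg
      (mul_nonneg (norm_nonneg _) ((norm_nonneg _).trans (norm_le_h2Norm _)))]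
    exact hb
  rw [hasDerivWithinAt_iff_isLittleO] at hlin ⊢
  refine (herr.add hlin).congr_left fun s => ?_
  simp

lemma afEnergy_eq (h : IsSolution β R u₀ T u) (hR : 0 ≤ R) (hT : T.OrdConnected)
    (h0 : (0 : ℝ) ∈ T) {t : ℝ} (ht : t ∈ T) : afEnergy β R (u t) = afEnergy β R u₀ := by
  have := eq_of_hasDerivWithinAt_zero hT (fun t ht => h.hasDerivWithinAt_afEnergy hR ht) h0 ht
  rwa [h.initial] at this

end IsSolution

/-! ### The `H¹` bound -/

section

variable {β R : ℝ} {u : L2}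

lemma hardy_toReal_le {f : L2} (hf : MemH1 f) :
    (hardy f).toReal ≤ 2 * ‖f‖ * ∑ j, ‖weakPartial j f‖ :=
  ENNReal.toReal_le_of_le_ofReal (mul_nonneg (mul_nonneg zero_le_two (norm_nonneg _))
    (Finset.sum_nonneg fun _ _ => norm_nonneg _)) hf.hardy_le

/-- Diamagnetic step: `i Pⱼu = ∂ⱼu + iβAⱼu`, and `ū · iβAⱼu` is purely imaginary, so `hⱼ = i Pⱼu` is
admissible in the Hardy-type inequality. -/
lemma hardy_toReal_le_magMomentum (hR : 0 ≤ R) (hu : MemH1 u) :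
    (hardy u).toReal ≤ 2 * ‖u‖ * ∑ j, ‖magMomentum β R u j u‖ := by
  have hu' := hu.hardy_ne_top
  have h := hu.hardy_le_of_re_eq (h := fun j => Complex.I • magMomentum β R u j u) fun j => by
    filter_upwards [coeFn_magMomentum (β := β) (j := j) hR hu' u,
      Lp.coeFn_smul Complex.I (magMomentum β R u j u)] with y h1 h2
    rw [h2, Pi.smul_apply, h1]
    simp only [smul_eq_mul, map_mul, map_add, map_neg, Complex.conj_I, Complex.conj_ofReal,
      conj_conv_dens_self]
    linear_combination ((starRingEnd ℂ) (weakPartial j u y) * u y +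
      (starRingEnd ℂ) (u y) * weakPartial j u y) * Complex.I_mul_I
  simp only [norm_smul, Complex.norm_I, one_mul] at h
  exact ENNReal.toReal_le_of_le_ofReal (mul_nonneg (mul_nonneg zero_le_two (norm_nonneg _))
    (Finset.sum_nonneg fun _ _ => norm_nonneg _)) h

lemma norm_le_h1Norm (f : L2) : ‖f‖ ≤ h1Norm f := by
  refine Real.le_sqrt_of_sq_le ?_
  have h1 : 0 ≤ ∑ j, ‖weakPartial j f‖ ^ 2 := Finset.sum_nonneg fun _ _ => sq_nonneg _
  linarith

lemma norm_weakPartial_le_h1Norm (f : L2) (j : Fin 2) : ‖weakPartial j f‖ ≤ h1Norm f := by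
  refine Real.le_sqrt_of_sq_le ?_
  have h := Finset.single_le_sum (f := fun j => ‖weakPartial j f‖ ^ 2) (fun _ _ => sq_nonneg _)
    (Finset.mem_univ j)
  have h3 := sq_nonneg ‖f‖
  linarith

lemma afEnergy_le (hR : 0 ≤ R) (hu : MemH1 u) :
    afEnergy β R u ≤ 2 * (h1Norm u * (1 + 144 * |β| * h1Norm u ^ 2)) ^ 2 := by
  set H := h1Norm u with hH
  have hm : ‖u‖ ≤ H := norm_le_h1Norm u
  have hH0 : 0 ≤ H := (norm_nonneg _).trans hm
  have hd : ∀ j, ‖weakPartial j u‖ ≤ H := norm_weakPartial_le_h1Norm u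
  have hN : (hardy u).toReal ≤ 4 * H ^ 2 := by
    refine (hardy_toReal_le hu).trans ?_
    rw [Fin.sum_univ_two]
    calc 2 * ‖u‖ * (‖weakPartial 0 u‖ + ‖weakPartial 1 u‖) ≤ 2 * H * (H + H) := by
          gcongr
          · exact hd 0
          · exact hd 1
      _ = 4 * H ^ 2 := by ring
  have hP : ∀ j, ‖magMomentum β R u j u‖ ^ 2 ≤ (H * (1 + 144 * |β| * H ^ 2)) ^ 2 := fun j => by
    gcongr
    calc ‖magMomentum β R u j u‖ ≤ ‖weakPartial j u‖ + |β| * (36 * (hardy u).toReal * ‖u‖) :=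
          norm_magMomentum_le hR hu.hardy_ne_top u
      _ ≤ H + |β| * (36 * (4 * H ^ 2) * H) := by
          gcongr
          exact hd j
      _ = _ := by ring
  rw [afEnergy, Fin.sum_univ_two]
  linarith [hP 0, hP 1]

/-- Bounding `A` through `Pⱼu` instead of `∂ⱼu` avoids a circular estimate, so no smallness of `β`
or of the mass is required. The constant is `144 = 36 · 4`. -/
lemma norm_weakPartial_le_of_afEnergy (hR : 0 ≤ R) (hu : MemH1 u) (j : Fin 2) :
    ‖weakPartial j u‖ ≤ √(afEnergy β R u) * (1 + 144 * |β| * ‖u‖ ^ 2) := by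
  set E := √(afEnergy β R u) with hE
  have hP : ∀ j, ‖magMomentum β R u j u‖ ≤ E := fun j => by
    refine Real.le_sqrt_of_sq_le ?_
    exact Finset.single_le_sum (f := fun j => ‖magMomentum β R u j u‖ ^ 2)
      (fun _ _ => sq_nonneg _) (Finset.mem_univ j)
  have hN : (hardy u).toReal ≤ 4 * ‖u‖ * E := by
    refine (hardy_toReal_le_magMomentum (β := β) hR hu).trans ?_
    rw [Fin.sum_univ_two]
    calc 2 * ‖u‖ * (‖magMomentum β R u 0 u‖ + ‖magMomentum β R u 1 u‖) ≤ 2 * ‖u‖ * (E + E) := by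
          gcongr
          · exact hP 0
          · exact hP 1
      _ = 4 * ‖u‖ * E := by ring
  calc ‖weakPartial j u‖ ≤ ‖magMomentum β R u j u‖ + |β| * (36 * (hardy u).toReal * ‖u‖) :=
        norm_weakPartial_le hR hu.hardy_ne_top u
    _ ≤ E + |β| * (36 * (4 * ‖u‖ * E) * ‖u‖) := by
        gcongr
        exact hP j
    _ = _ := by ring

/-- The uniform bound for the `H¹` norm along the flow. -/
noncomputable def h1Bound (β H : ℝ) : ℝ :=
  √(H ^ 2 + 2 * (√(2 * (H * (1 + 144 * |β| * H ^ 2)) ^ 2) * (1 + 144 * |β| * H ^ 2)) ^ 2)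

lemma h1Norm_le_of_afEnergy_le (hR : 0 ≤ R) (hu : MemH1 u) {u₀ : L2} (hu₀ : MemH1 u₀)
    (hm : ‖u‖ = ‖u₀‖) (hE : afEnergy β R u ≤ afEnergy β R u₀) :
    h1Norm u ≤ h1Bound β (h1Norm u₀) := by
  have hmH : ‖u‖ ≤ h1Norm u₀ := hm.le.trans (norm_le_h1Norm u₀)
  have hH0 : 0 ≤ h1Norm u₀ := (norm_nonneg _).trans hmH
  have hd : ∀ j, ‖weakPartial j u‖ ^ 2 ≤
      (√(2 * (h1Norm u₀ * (1 + 144 * |β| * h1Norm u₀ ^ 2)) ^ 2) *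
        (1 + 144 * |β| * h1Norm u₀ ^ 2)) ^ 2 := fun j => by
    gcongr
    refine (norm_weakPartial_le_of_afEnergy (β := β) hR hu j).trans ?_
    gcongr
    exact hE.trans (afEnergy_le hR hu₀)
  unfold h1Bound
  rw [h1Norm, Fin.sum_univ_two]
  refine Real.sqrt_le_sqrt ?_
  have h1 : ‖u‖ ^ 2 ≤ h1Norm u₀ ^ 2 := by gcongr
  linarith [hd 0, hd 1]

end

end CSS

theorem theorem3p1 :
    ∃ c : ℝ, 0 < c ∧ ∃ C : ℝ → ℝ → ℝ,
      ∀ (β R : ℝ), 0 ≤ R → R ≤ c →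
      ∀ (T : Set ℝ), T.OrdConnected → (0 : ℝ) ∈ T → T ⊆ Set.Ici 0 →
      ∀ (u₀ : CSS.L2) (u : ℝ → CSS.L2), CSS.IsSolution β R u₀ T u →
        (∀ t ∈ T, CSS.afEnergy β R (u t) = CSS.afEnergy β R u₀) ∧
        (∀ t ∈ T, CSS.h1Norm (u t) ≤ C β (CSS.h1Norm u₀)) := by
  -- The threshold `1` is arbitrary: the kernel bound has the same constant for every nonnegative
  -- radius.
  refine ⟨1, one_pos, CSS.h1Bound, fun β R hR _ T hT h0 _ u₀ u hu => ?_⟩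
  have hE : ∀ t ∈ T, CSS.afEnergy β R (u t) = CSS.afEnergy β R u₀ :=
    fun t ht => hu.afEnergy_eq hR hT h0 ht
  refine ⟨hE, fun t ht => ?_⟩
  have h₀ : CSS.MemH1 u₀ := hu.initial ▸ (hu.memH2 0 h0).memH1
  exact CSS.h1Norm_le_of_afEnergy_le hR (hu.memH2 t ht).memH1 h₀ (hu.norm_eq hR hT h0 ht)
    (hE t ht).le
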